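/- Notation. Let $\mathcal C_+=\{p\in\mathbb R^4 : p_0>0,\ p_0^2=p_1^2+p_2^2+p_3^2\}$ be the mantle of the forward light cone with the Lorentz invariant measure $\mu_0(dp)=d^3p/(2p_0)$, and write $pa=p_0a_0-p_1a_1-p_2a_2-p_3a_3$. For $p\in\mathbb R^4$ put $P=\begin{pmatrix}p_0+p_3&p_1-ip_2\\p_1+ip_2&p_0-p_3\end{pmatrix}$ and $P^\dagger=\tfrac12\begin{pmatrix}p_0-p_3&-p_1+ip_2\\-p_1-ip_2&p_0+p_3\end{pmatrix}$. For $A\in SL(2,\mathbb C)$ let $\Lambda_A$ be the Lorentz transformation $P\mapsto APA^*$, and let $\mathcal P=SL(2,\mathbb C)\ltimes\mathbb R^4$ with $(A,a)(B,b)=(AB,a+\Lambda_Ab)$. For $p\in\mathcal C_+$ with $p_3\neq-p_0$ (the exceptional set is $\mu_0$-null) let $$H_p=\frac1{\sqrt{2p_0(p_0+p_3)}}\begin{pmatrix}-\sqrt{p_0}\,(p_0+p_3)&\frac{p_1-ip_2}{\sqrt{p_0}}\\-\sqrt{p_0}\,(p_1+ip_2)&-\frac{p_0+p_3}{\sqrt{p_0}}\end{pmatrix}.$$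 Let $n\in\mathbb N$, let $\mathcal H=\mathrm{Sym}(\bigotimes^n\mathbb C^2)$ with its standard scalar product, and for a complex $2\times2$ matrix $M$ let $D_+(M)=\bigotimes^n\overline M$ and $D_-(M)=\bigotimes^nM$, acting on $\mathcal H$. Put $\beta_\pm(p)=D_\pm(P^\dagger)$ and $\langle\varphi,\psi\rangle_{\beta_\pm}=\int_{\mathcal C_+}\langle\varphi(p),\beta_\pm(p)\psi(p)\rangle\,\mu_0(dp)$, and let $\mathfrak H_{n,\pm}$ be the space of measurable functions $\varphi:\mathcal C_+\to\mathcal H$ with $\langle\varphi,\varphi\rangle_{\beta_\pm}<\infty$. Let $\mathfrak H'_{n,\pm}$ be the quotient of $\mathfrak H_{n,\pm}$ by the null space $\{\varphi:\langle\varphi,\varphi\rangle_{\beta_\pm}=0\}$, with the scalar product induced by $\langle\cdot,\cdot\rangle_{\beta_\pm}$; $[\varphi]_\pm$ denotes the class of $\varphi$. For $g=(A,a)\in\mathcal P$ and $q=\Lambda_A^{-1}p$ put $$(V_1(g)\varphi)(p)=e^{-ipa}D_+(A)\varphi(q)\quad(\varphi\in\mathfrak H_{n,+}),\qquad (V_2(g)\varphi)(p)=e^{-ipa}D_-(A)\varphi(q)\quad(\varphi\in\mathfrak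 H_{n,-}),$$ and, for $\chi\in L^2(\mathcal C_+,\mathbb C,\mu_0)$, $$(U_\pm(g)\chi)(p)=e^{-ipa}\bigl(e^{\pm\frac i2\theta(A,p)}\bigr)^n\chi(q),\qquad e^{-\frac i2\theta(A,p)}=\bigl(H_p^{-1}AH_q\bigr)_{22}.$$ Theorem. For every $n\in\mathbb N$ and each sign: 1. $U_\pm$ is an irreducible unitary representation of $\mathcal P$ on $L^2(\mathcal C_+,\mathbb C,\mu_0)$ (the massless Wigner representation of helicity $\pm n/2$). 2. $V_1$ (for the sign $+$) and $V_2$ (for the sign $-$) map $\mathfrak H_{n,\pm}$ into itself and lift to unitary representations $V_1'$ and $V_2'$ of $\mathcal P$ on $\mathfrak H'_{n,+}$ and $\mathfrak H'_{n,-}$, given by $V_1'(g)[\varphi]_+=[V_1(g)\varphi]_+$ and $V_2'(g)[\varphi]_-=[V_2(g)\varphi]_-$. 3. The representations $V_1'$ and $V_2'$ are unitarily equivalent to $U_+$ and $U_-$, respectively: with $e_2=\binom01$, the formula $$\Phi_\pm\chi=\Bigl[\,p\mapsto \chi(p)\,D_\pm(H_p)\bigl(\textstyle\bigotimes^n e_2\bigr)\Bigr]_\pm$$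 defines a surjective linear isometry $\Phi_\pm:L^2(\mathcal C_+,\mathbb C,\mu_0)\to\mathfrak H'_{n,\pm}$, and $\Phi_+U_+(g)=V_1'(g)\Phi_+$ and $\Phi_-U_-(g)=V_2'(g)\Phi_-$ for all $g\in\mathcal P$. -/

import Mathlib

open MeasureTheory
open scoped ComplexConjugate

namespace MasslessWigner

noncomputable section

/-! ### Minkowski space, the Lorentz action of `SL(2,ℂ)` and the Poincaré group -/

/-- Minkowski space `ℝ⁴`, with coordinates `(p₀, p₁, p₂, p₃)`. -/
abbrev Mink : Type := Fin 4 → ℝ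

/-- The group `SL(2,ℂ)`. -/
abbrev SL2C : Type := Matrix.SpecialLinearGroup (Fin 2) ℂ

/-- The Minkowski scalar product `p a = p₀a₀ - p₁a₁ - p₂a₂ - p₃a₃`. -/
def mdot (p a : Mink) : ℝ := p 0 * a 0 - p 1 * a 1 - p 2 * a 2 - p 3 * a 3

/-- The Hermitian matrix `P = p₀σ₀ + p₁σ₁ + p₂σ₂ + p₃σ₃`. -/
def toHerm (p : Mink) : Matrix (Fin 2) (Fin 2) ℂ :=
  !![(p 0 : ℂ) + p 3, (p 1 : ℂ) - Complex.I * p 2;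
     (p 1 : ℂ) + Complex.I * p 2, (p 0 : ℂ) - p 3]

/-- The coordinates of a Hermitian `2 × 2` matrix; the inverse of `toHerm`. -/
def ofHerm (M : Matrix (Fin 2) (Fin 2) ℂ) : Mink :=
  ![((M 0 0).re + (M 1 1).re) / 2, (M 1 0).re, (M 1 0).im, ((M 0 0).re - (M 1 1).re) / 2]

theorem ofHerm_toHerm (p : Mink) : ofHerm (toHerm p) = p := by
  funext i
  fin_cases i <;> simp [ofHerm, toHerm]

theorem toHerm_isHermitian (p : Mink) : (toHerm p).IsHermitian := by
  ext i j
  fin_cases i <;> fin_cases j <;>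
    simp [toHerm, Matrix.conjTranspose_apply, Complex.conj_ofReal, sub_eq_add_neg]

theorem toHerm_ofHerm {M : Matrix (Fin 2) (Fin 2) ℂ} (hM : M.IsHermitian) :
    toHerm (ofHerm M) = M := by
  have h00 := congrArg Complex.im (hM.apply 0 0)
  have h11 := congrArg Complex.im (hM.apply 1 1)
  have h01 := hM.apply 0 1
  simp at h00 h11
  ext i j
  fin_cases i <;> fin_cases j
  · apply Complex.ext <;> simp [toHerm, ofHerm] <;> linarith
  · change toHerm (ofHerm M) 0 1 = M 0 1
    rw [← hM.apply 0 1]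
    apply Complex.ext <;> simp [toHerm, ofHerm]
  · apply Complex.ext <;> simp [toHerm, ofHerm]
  · apply Complex.ext <;> simp [toHerm, ofHerm] <;> linarith

theorem toHerm_add (p q : Mink) : toHerm (p + q) = toHerm p + toHerm q := by
  ext i j
  fin_cases i <;> fin_cases j <;> simp [toHerm] <;> ring

theorem toHerm_smul (c : ℝ) (p : Mink) : toHerm (c • p) = (c : ℂ) • toHerm p := by
  ext i j
  fin_cases i <;> fin_cases j <;> simp [toHerm] <;> ring

theorem toHerm_injective : Function.Injective toHerm :=
  Function.LeftInverse.injective ofHerm_toHerm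

/-- `Λ_A x`, the vector whose Hermitian matrix is `A X A*`. -/
def lorentzFun (A : SL2C) (x : Mink) : Mink :=
  ofHerm ((A : Matrix (Fin 2) (Fin 2) ℂ) * toHerm x * (A : Matrix (Fin 2) (Fin 2) ℂ).conjTranspose)

theorem toHerm_lorentzFun (A : SL2C) (x : Mink) :
    toHerm (lorentzFun A x) = (A : Matrix (Fin 2) (Fin 2) ℂ) * toHerm x *
      (A : Matrix (Fin 2) (Fin 2) ℂ).conjTranspose :=
  toHerm_ofHerm (Matrix.isHermitian_mul_mul_conjTranspose _ (toHerm_isHermitian x))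

theorem lorentzFun_one (x : Mink) : lorentzFun 1 x = x := by
  apply toHerm_injective
  simp [toHerm_lorentzFun]

theorem lorentzFun_mul (A B : SL2C) (x : Mink) :
    lorentzFun (A * B) x = lorentzFun A (lorentzFun B x) := by
  apply toHerm_injective
  simp [toHerm_lorentzFun, Matrix.mul_assoc]

/-- The Lorentz transformation `Λ_A` as a linear automorphism of Minkowski space. -/
def lorentz (A : SL2C) : Mink ≃ₗ[ℝ] Mink where
  toFun := lorentzFun A
  invFun := lorentzFun A⁻¹
  map_add' x y := by
    apply toHerm_injective
    simp only [toHerm_lorentzFun, toHerm_add, Matrix.mul_add, Matrix.add_mul]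
  map_smul' c x := by
    apply toHerm_injective
    simp only [toHerm_lorentzFun, toHerm_smul, RingHom.id_apply, Matrix.mul_smul, Matrix.smul_mul]
  left_inv x := by rw [← lorentzFun_mul, inv_mul_cancel, lorentzFun_one]
  right_inv x := by rw [← lorentzFun_mul, mul_inv_cancel, lorentzFun_one]

/-- The action of `SL(2,ℂ)` on the translation group `ℝ⁴`. -/
def lorentzAction : SL2C →* MulAut (Multiplicative Mink) where
  toFun A := AddEquiv.toMultiplicative (lorentz A).toAddEquiv
  map_one' := by
    ext x : 1
    exact congrArg Multiplicative.ofAdd (lorentzFun_one x.toAdd)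
  map_mul' A B := by
    ext x : 1
    exact congrArg Multiplicative.ofAdd (lorentzFun_mul A B x.toAdd)

/-- The universal cover `SL(2,ℂ) ⋉ ℝ⁴` of the proper orthochronous Poincaré group, with the product
`(A, a)(B, b) = (AB, a + Λ_A b)`. -/
abbrev Poincare : Type := Multiplicative Mink ⋊[lorentzAction] SL2C

/-- The homogeneous part `A ∈ SL(2,ℂ)` of `g = (A, a)`. -/
def Poincare.hom (g : Poincare) : SL2C := g.right

/-- The translation part `a ∈ ℝ⁴` of `g = (A, a)`. -/
def Poincare.trans (g : Poincare) : Mink := g.left.toAdd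

/-! ### The light cone and its invariant measure -/

/-- The mantle of the forward light cone (without the apex), the `SL(2,ℂ)`-orbit of
`(1, 0, 0, 1)`. -/
def lightCone : Set Mink := {p | 0 < p 0 ∧ p 0 ^ 2 = p 1 ^ 2 + p 2 ^ 2 + p 3 ^ 2}

theorem det_toHerm (p : Mink) :
    (toHerm p).det = ((p 0 ^ 2 - (p 1 ^ 2 + p 2 ^ 2 + p 3 ^ 2) : ℝ) : ℂ) := by
  rw [Matrix.det_fin_two]
  simp only [toHerm, Matrix.of_apply, Matrix.cons_val', Matrix.cons_val_zero,
    Matrix.cons_val_one, Matrix.cons_val_fin_one]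
  push_cast
  linear_combination ((p 2 : ℂ) ^ 2) * Complex.I_sq

theorem toHerm_sq {p : Mink} (hp : p ∈ lightCone) :
    toHerm p * toHerm p = (2 * p 0 : ℂ) • toHerm p := by
  have h : (p 0 : ℂ) ^ 2 = (p 1 : ℂ) ^ 2 + (p 2 : ℂ) ^ 2 + (p 3 : ℂ) ^ 2 := by
    exact_mod_cast congrArg (fun x : ℝ => (x : ℂ)) hp.2
  have hI := Complex.I_sq
  ext i j
  fin_cases i <;> fin_cases j <;> simp [toHerm, Matrix.mul_apply, Fin.sum_univ_two]
  · linear_combination (-(p 2 : ℂ) ^ 2) * hI - h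
  · ring
  · ring
  · linear_combination (-(p 2 : ℂ) ^ 2) * hI - h

theorem lorentzFun_mem_lightCone (A : SL2C) {p : Mink} (hp : p ∈ lightCone) :
    lorentzFun A p ∈ lightCone := by
  set A' : Matrix (Fin 2) (Fin 2) ℂ := (A : Matrix (Fin 2) (Fin 2) ℂ) with hA'
  have hdet : A'.det = 1 := A.2
  have hP := toHerm_lorentzFun A p
  have hq : (toHerm (lorentzFun A p)).det = 0 := by
    rw [hP, Matrix.det_mul, Matrix.det_mul, det_toHerm, hp.2]
    simp
  rw [det_toHerm, Complex.ofReal_eq_zero, sub_eq_zero] at hq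
  refine ⟨?_, hq⟩
  have hp0 := hp.1
  have hB : (2 * p 0 : ℂ) • toHerm (lorentzFun A p) =
      (A' * toHerm p) * (A' * toHerm p).conjTranspose := by
    rw [Matrix.conjTranspose_mul, (toHerm_isHermitian p).eq, hP, ← Matrix.smul_mul,
      ← Matrix.mul_smul, ← toHerm_sq hp]
    simp only [Matrix.mul_assoc, hA']
  have htr := congrArg (fun M => M.trace.re) hB
  have hsum : (2 * p 0) * (2 * lorentzFun A p 0) =
      ∑ i, ∑ j, Complex.normSq ((A' * toHerm p) i j) := by
    have h1 : (((2 * p 0 : ℂ) • toHerm (lorentzFun A p)).trace).re =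
        (2 * p 0) * (2 * lorentzFun A p 0) := by
      simp [Matrix.trace, Fin.sum_univ_two, toHerm]
      ring
    rw [← h1, htr]
    generalize A' * toHerm p = N
    simp [Matrix.trace, Matrix.diag, Matrix.mul_apply, Fin.sum_univ_two, Complex.normSq_apply]
  have hnn : 0 ≤ ∑ i, ∑ j, Complex.normSq ((A' * toHerm p) i j) :=
    Finset.sum_nonneg fun i _ => Finset.sum_nonneg fun j _ => Complex.normSq_nonneg _
  rcases hnn.lt_or_eq with h | h
  · nlinarith
  · exfalso
    have hz : A' * toHerm p = 0 := by
      ext i j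
      have h2 := (Finset.sum_eq_zero_iff_of_nonneg (fun i _ =>
        Finset.sum_nonneg fun j _ => Complex.normSq_nonneg _)).1 h.symm i (Finset.mem_univ i)
      have h3 := (Finset.sum_eq_zero_iff_of_nonneg (fun j _ =>
        Complex.normSq_nonneg _)).1 h2 j (Finset.mem_univ j)
      exact Complex.normSq_eq_zero.1 h3
    have hz' : toHerm p = 0 := by
      have : A'.adjugate * (A' * toHerm p) = toHerm p := by
        rw [← Matrix.mul_assoc, Matrix.adjugate_mul, hdet, one_smul, Matrix.one_mul]
      rw [← this, hz, Matrix.mul_zero]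
    have := congrFun (ofHerm_toHerm p) 0
    rw [hz'] at this
    simp [ofHerm] at this
    linarith

/-- The action of `Λ_A` on the light cone. -/
def coneAct (A : SL2C) (p : lightCone) : lightCone :=
  ⟨lorentzFun A p, lorentzFun_mem_lightCone A p.2⟩

/-- The energy `|k| = √(k₁² + k₂² + k₃²)` of a massless particle of momentum `k`. -/
def energy (k : Fin 3 → ℝ) : ℝ := Real.sqrt (k 0 ^ 2 + k 1 ^ 2 + k 2 ^ 2)

/-- The Lorentz invariant measure `d³p / (2p₀)` on the light cone: the image of the measure
`d³k / (2|k|)` on `ℝ³` under `k ↦ (|k|, k)`. -/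
def coneMeasure : Measure lightCone :=
  Measure.comap Subtype.val
    (Measure.map (fun k : Fin 3 → ℝ => (![energy k, k 0, k 1, k 2] : Mink))
      ((volume : Measure (Fin 3 → ℝ)).withDensity fun k => ENNReal.ofReal (1 / (2 * energy k))))

/-! ### Spinor spaces -/

/-- `⊗ⁿ ℂ²` with its standard Hilbert space structure, in components with respect to the basis
`e_{i₁} ⊗ ⋯ ⊗ e_{iₙ}`. -/
abbrev Tens (n : ℕ) : Type := EuclideanSpace ℂ (Fin n → Fin 2)

/-- The spinor space `Sym(⊗ⁿ ℂ²)`, the tensors invariant under all permutations of the factors. -/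
def Spin (n : ℕ) : Submodule ℂ (Tens n) where
  carrier := {t | ∀ (σ : Equiv.Perm (Fin n)) (i : Fin n → Fin 2), t (i ∘ σ) = t i}
  add_mem' hs ht σ i := by simp [hs σ i, ht σ i]
  zero_mem' σ i := by simp
  smul_mem' c t ht σ i := by simp [ht σ i]

/-- The matrix of `⊗ⁿ M`. -/
def tensMat (n : ℕ) (M : Matrix (Fin 2) (Fin 2) ℂ) :
    Matrix (Fin n → Fin 2) (Fin n → Fin 2) ℂ :=
  Matrix.of fun i j => ∏ k, M (i k) (j k)

/-- The linear map `⊗ⁿ M` on `⊗ⁿ ℂ²`. -/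
def tensPow (n : ℕ) (M : Matrix (Fin 2) (Fin 2) ℂ) : Tens n →ₗ[ℂ] Tens n :=
  Matrix.toEuclideanLin (tensMat n M)

theorem tensPow_apply (n : ℕ) (M : Matrix (Fin 2) (Fin 2) ℂ) (t : Tens n) (i : Fin n → Fin 2) :
    tensPow n M t i = ∑ j, (∏ k, M (i k) (j k)) * t j := by
  simp [tensPow, tensMat, Matrix.mulVec, dotProduct]

theorem tensPow_mem_spin (n : ℕ) (M : Matrix (Fin 2) (Fin 2) ℂ) (t : Tens n) (ht : t ∈ Spin n) :
    tensPow n M t ∈ Spin n := by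
  intro σ i
  rw [tensPow_apply, tensPow_apply]
  refine (Fintype.sum_equiv (σ.arrowCongr (Equiv.refl (Fin 2))).symm _ _ fun j => ?_).symm
  have h1 : (σ.arrowCongr (Equiv.refl (Fin 2))).symm j = j ∘ σ := rfl
  rw [h1, ht σ j]
  congr 1
  exact (Equiv.prod_comp σ fun k => M (i k) (j k)).symm

/-- `⊗ⁿ M` restricted to `Sym(⊗ⁿ ℂ²)`. -/
def spinPow (n : ℕ) (M : Matrix (Fin 2) (Fin 2) ℂ) : Spin n →ₗ[ℂ] Spin n :=
  (tensPow n M).restrict (tensPow_mem_spin n M)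

/-- The vector `v ⊗ ⋯ ⊗ v` in `Sym(⊗ⁿ ℂ²)`. -/
def spinVec (n : ℕ) (v : Fin 2 → ℂ) : Spin n :=
  ⟨WithLp.toLp 2 fun i => ∏ k, v (i k), fun σ i => Equiv.prod_comp σ fun k => v (i k)⟩

/-- The sign of the helicity. -/
inductive Helicity : Type
  | plus : Helicity
  | minus : Helicity

/-- The complex conjugate of `M` for the index `+`, and `M` itself for the index `-`. -/
def twist : Helicity → Matrix (Fin 2) (Fin 2) ℂ → Matrix (Fin 2) (Fin 2) ℂ
  | Helicity.plus, M => M.map (starRingEnd ℂ)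
  | Helicity.minus, M => M

/-- `D^{(0,n/2)}(M) = ⊗ⁿ (conjugate of M)` for the index `+`, and `D^{(n/2,0)}(M) = ⊗ⁿ M` for the
index `-`. -/
def rep (s : Helicity) (n : ℕ) (M : Matrix (Fin 2) (Fin 2) ℂ) : Spin n →ₗ[ℂ] Spin n :=
  spinPow n (twist s M)

/-- The matrix `P† = (p₀σ₀ - p₁σ₁ - p₂σ₂ - p₃σ₃) / 2`. -/
def pDagger (p : Mink) : Matrix (Fin 2) (Fin 2) ℂ :=
  (1 / 2 : ℂ) • !![(p 0 : ℂ) - p 3, -(p 1 : ℂ) + Complex.I * p 2;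
     -(p 1 : ℂ) - Complex.I * p 2, (p 0 : ℂ) + p 3]

/-- `β₊(p) = D^{(0,n/2)}(P†)` and `β₋(p) = D^{(n/2,0)}(P†)`. -/
def beta (s : Helicity) (n : ℕ) (p : Mink) : Spin n →ₗ[ℂ] Spin n :=
  rep s n (pDagger p)

/-! Positivity of `β±(p)` -/

theorem tensPow_mul (n : ℕ) (M N : Matrix (Fin 2) (Fin 2) ℂ) (t : Tens n) :
    tensPow n (M * N) t = tensPow n M (tensPow n N t) := by
  ext i
  simp only [tensPow_apply, Matrix.mul_apply, Finset.prod_univ_sum, Fintype.piFinset_univ,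
    Finset.mul_sum, Finset.sum_mul, Finset.prod_mul_distrib]
  rw [Finset.sum_comm]
  exact Finset.sum_congr rfl fun j _ => Finset.sum_congr rfl fun l _ => by ring

theorem tensPow_smul (n : ℕ) (c : ℂ) (M : Matrix (Fin 2) (Fin 2) ℂ) (t : Tens n) :
    tensPow n (c • M) t = c ^ n • tensPow n M t := by
  ext i
  simp [tensPow_apply, Finset.prod_mul_distrib, Finset.mul_sum, mul_assoc]

theorem inner_tensPow (n : ℕ) {M : Matrix (Fin 2) (Fin 2) ℂ} (hM : M.IsHermitian) (t u : Tens n) :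
    inner ℂ (tensPow n M t) u = inner ℂ t (tensPow n M u) := by
  simp only [PiLp.inner_apply, tensPow_apply, RCLike.inner_apply, map_sum, map_mul, map_prod,
    Finset.mul_sum, Finset.sum_mul]
  rw [Finset.sum_comm]
  refine Finset.sum_congr rfl fun j _ => Finset.sum_congr rfl fun i _ => ?_
  have : ∀ k, (starRingEnd ℂ) (M (i k) (j k)) = M (j k) (i k) := fun k => hM.apply _ _
  simp only [this]
  ring

theorem twist_pDagger_isHermitian (s : Helicity) (p : Mink) :
    (twist s (pDagger p)).IsHermitian := by
  have h2 : (starRingEnd ℂ) (2 : ℂ) = 2 := map_ofNat _ 2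
  cases s <;> ext i j <;> fin_cases i <;> fin_cases j <;>
    simp [twist, pDagger, Matrix.conjTranspose_apply, Complex.conj_ofReal, sub_eq_add_neg, h2]

theorem twist_pDagger_sq (s : Helicity) {p : Mink} (hp : p ∈ lightCone) :
    twist s (pDagger p) * twist s (pDagger p) = (p 0 : ℂ) • twist s (pDagger p) := by
  have h : (p 0 : ℂ) ^ 2 = (p 1 : ℂ) ^ 2 + (p 2 : ℂ) ^ 2 + (p 3 : ℂ) ^ 2 := by
    exact_mod_cast congrArg (fun x : ℝ => (x : ℂ)) hp.2
  have hI := Complex.I_sq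
  have h2 : (starRingEnd ℂ) (2 : ℂ) = 2 := map_ofNat _ 2
  cases s <;> ext i j <;> fin_cases i <;> fin_cases j <;>
    simp [twist, pDagger, Matrix.mul_apply, Fin.sum_univ_two, Complex.conj_ofReal, h2]
  · linear_combination (-(p 2 : ℂ) ^ 2 / 4) * hI - h / 4
  · ring
  · ring
  · linear_combination (-(p 2 : ℂ) ^ 2 / 4) * hI - h / 4
  · linear_combination (-(p 2 : ℂ) ^ 2 / 4) * hI - h / 4
  · ring
  · ring
  · linear_combination (-(p 2 : ℂ) ^ 2 / 4) * hI - h / 4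

theorem inner_beta_symm (s : Helicity) (n : ℕ) (p : Mink) (v w : Spin n) :
    inner ℂ (beta s n p v : Tens n) (w : Tens n) = inner ℂ (v : Tens n) (beta s n p w : Tens n) :=
  inner_tensPow n (twist_pDagger_isHermitian s p) v w

theorem inner_beta_beta (s : Helicity) (n : ℕ) (p : lightCone) (v w : Spin n) :
    inner ℂ (beta s n p v : Tens n) (beta s n p w : Tens n) =
      ((p : Mink) 0 : ℂ) ^ n * inner ℂ (v : Tens n) (beta s n p w : Tens n) := by
  have h : (beta s n p (beta s n p w) : Tens n) =
      ((p : Mink) 0 : ℂ) ^ n • (beta s n p w : Tens n) := by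
    change tensPow n _ (tensPow n _ (w : Tens n)) = _ • tensPow n _ (w : Tens n)
    rw [← tensPow_mul, twist_pDagger_sq s p.2, tensPow_smul]
  rw [inner_beta_symm, h, inner_smul_right]

theorem inner_beta_self (s : Helicity) (n : ℕ) (p : lightCone) (v : Spin n) :
    inner ℂ (v : Tens n) (beta s n p v : Tens n) =
      (((((p : Mink) 0) ^ n)⁻¹ * ‖(beta s n p v : Tens n)‖ ^ 2 : ℝ) : ℂ) := by
  have hp : ((p : Mink) 0 : ℂ) ^ n ≠ 0 := pow_ne_zero _ (by exact_mod_cast p.2.1.ne')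
  have h := inner_beta_beta s n p v v
  rw [inner_self_eq_norm_sq_to_K] at h
  push_cast
  rw [eq_inv_mul_iff_mul_eq₀ hp, ← h]
  rfl

theorem norm_inner_beta_le (s : Helicity) (n : ℕ) (p : lightCone) (v w : Spin n) :
    ‖(inner ℂ (v : Tens n) (beta s n p w : Tens n) : ℂ)‖ ≤
      ‖(inner ℂ (v : Tens n) (beta s n p v : Tens n) : ℂ)‖ +
        ‖(inner ℂ (w : Tens n) (beta s n p w : Tens n) : ℂ)‖ := by
  have hp : 0 < ((p : Mink) 0) ^ n := pow_pos p.2.1 n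
  have key : ∀ x y : Spin n, ((p : Mink) 0) ^ n *
      ‖(inner ℂ (x : Tens n) (beta s n p y : Tens n) : ℂ)‖ =
        ‖(inner ℂ (beta s n p x : Tens n) (beta s n p y : Tens n) : ℂ)‖ := by
    intro x y
    rw [inner_beta_beta, norm_mul, norm_pow, Complex.norm_real, Real.norm_of_nonneg p.2.1.le]
  have hself : ∀ x : Tens n, ‖(inner ℂ x x : ℂ)‖ = ‖x‖ ^ 2 := by
    intro x
    rw [inner_self_eq_norm_sq_to_K]
    simp
  rw [← mul_le_mul_iff_right₀ hp, mul_add, key, key, key, hself, hself]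
  have := norm_inner_le_norm (𝕜 := ℂ) (beta s n p v : Tens n) (beta s n p w : Tens n)
  nlinarith [sq_nonneg (‖(beta s n p v : Tens n)‖ - ‖(beta s n p w : Tens n)‖),
    sq_nonneg ‖(beta s n p v : Tens n)‖, sq_nonneg ‖(beta s n p w : Tens n)‖]

/-! ### The spaces with semidefinite form and their factor spaces -/

/-- The integrand `p ↦ ⟨φ(p), β±(p) ψ(p)⟩`, with the scalar product of `⊗ⁿ ℂ²`. -/
def density (s : Helicity) (n : ℕ) (φ ψ : lightCone → Spin n) (p : lightCone) : ℂ :=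
  inner ℂ (φ p : Tens n) (beta s n p (ψ p) : Tens n)

/-- The sesquilinear form `⟨φ, ψ⟩_β = ∫ ⟨φ(p), β±(p) ψ(p)⟩ μ₀(dp)`, antilinear in `φ`. -/
def betaForm (s : Helicity) (n : ℕ) (φ ψ : lightCone → Spin n) : ℂ :=
  ∫ p, density s n φ ψ p ∂coneMeasure

theorem measurable_beta (s : Helicity) (n : ℕ) {ψ : lightCone → Spin n} (hψ : Measurable ψ) :
    Measurable fun p : lightCone => beta s n p (ψ p) := by
  refine Measurable.subtype_mk (f := fun p : lightCone =>
    tensPow n (twist s (pDagger p)) (ψ p : Tens n)) (h := fun p => (beta s n p (ψ p)).2) ?_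
  have hent : ∀ i j : Fin 2, Measurable fun p : lightCone => twist s (pDagger p) i j := by
    intro i j
    have hc : ∀ k : Fin 4, Measurable fun p : lightCone => (((p : Mink) k : ℝ) : ℂ) := fun k =>
      Complex.measurable_ofReal.comp ((measurable_pi_apply k).comp measurable_subtype_coe)
    have h0 := hc 0
    have h1 := hc 1
    have h2 := hc 2
    have h3 := hc 3
    cases s <;> fin_cases i <;> fin_cases j <;>
      simp [twist, pDagger, Complex.conj_ofReal] <;> fun_prop
  have hcomp : ∀ i, Measurable fun p : lightCone =>
      tensPow n (twist s (pDagger p)) (ψ p : Tens n) i := by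
    intro i
    simp only [tensPow_apply]
    refine Finset.measurable_sum _ fun j _ => Measurable.mul
      (Finset.measurable_prod _ fun k _ => hent _ _) ?_
    have : Measurable fun t : Tens n => t j := (EuclideanSpace.proj j).continuous.measurable
    exact this.comp (measurable_subtype_coe.comp hψ)
  exact (MeasurableEquiv.toLp 2 ((Fin n → Fin 2) → ℂ)).measurable.comp (measurable_pi_lambda _ hcomp)

theorem measurable_density (s : Helicity) (n : ℕ) {φ ψ : lightCone → Spin n} (hφ : Measurable φ)
    (hψ : Measurable ψ) : Measurable (density s n φ ψ) :=
  (measurable_subtype_coe.comp hφ).inner (measurable_subtype_coe.comp (measurable_beta s n hψ))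

theorem integrable_density (s : Helicity) (n : ℕ) {φ ψ : lightCone → Spin n} (hφ : Measurable φ)
    (hψ : Measurable ψ) (iφ : Integrable (density s n φ φ) coneMeasure)
    (iψ : Integrable (density s n ψ ψ) coneMeasure) :
    Integrable (density s n φ ψ) coneMeasure :=
  (iφ.norm.add iψ.norm).mono' (measurable_density s n hφ hψ).aestronglyMeasurable
    (Filter.Eventually.of_forall fun p => norm_inner_beta_le s n p (φ p) (ψ p))

/-- The space `𝔥_{n,±}` of measurable `Sym(⊗ⁿ ℂ²)`-valued functions `φ` on the light cone with
`⟨φ, φ⟩_β < ∞`. -/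
def preSpace (s : Helicity) (n : ℕ) : Submodule ℂ (lightCone → Spin n) where
  carrier := {φ | Measurable φ ∧ Integrable (density s n φ φ) coneMeasure}
  add_mem' := by
    rintro φ ψ ⟨mφ, iφ⟩ ⟨mψ, iψ⟩
    refine ⟨mφ.add mψ, ?_⟩
    have h : density s n (φ + ψ) (φ + ψ) = (density s n φ φ + density s n φ ψ) +
        (density s n ψ φ + density s n ψ ψ) := by
      funext p
      simp only [density, Pi.add_apply, map_add, Submodule.coe_add, inner_add_left, inner_add_right]
      ring
    rw [h]
    exact (iφ.add (integrable_density s n mφ mψ iφ iψ)).add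
      ((integrable_density s n mψ mφ iψ iφ).add iψ)
  zero_mem' := by
    refine ⟨measurable_zero, ?_⟩
    have h : density s n 0 0 = fun _ => 0 := by
      funext p
      simp [density]
    rw [h]
    exact integrable_zero _ _ _
  smul_mem' := by
    rintro c φ ⟨mφ, iφ⟩
    refine ⟨mφ.const_smul c, ?_⟩
    have h : density s n (c • φ) (c • φ) = fun p => (starRingEnd ℂ c * c) * density s n φ φ p := by
      funext p
      simp only [density, Pi.smul_apply, map_smul, Submodule.coe_smul, inner_smul_left,
        inner_smul_right]
      ring
    rw [h]
    exact iφ.const_mul _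

theorem preSpace_integrable {s : Helicity} {n : ℕ} (φ ψ : preSpace s n) :
    Integrable (density s n φ ψ) coneMeasure :=
  integrable_density s n φ.2.1 ψ.2.1 φ.2.2 ψ.2.2

/-- `⟨·, ·⟩_β` is a positive semidefinite Hermitian form on `𝔥_{n,±}`. -/
@[reducible] def preCore (s : Helicity) (n : ℕ) : PreInnerProductSpace.Core ℂ (preSpace s n) where
  inner φ ψ := betaForm s n φ ψ
  conj_inner_symm φ ψ := by
    rw [betaForm, betaForm, ← integral_conj]
    refine integral_congr_ae (Filter.Eventually.of_forall fun p => ?_)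
    simp only [density]
    rw [inner_conj_symm, inner_beta_symm]
  re_inner_nonneg φ := by
    have h : betaForm s n φ φ = ((∫ p : lightCone, (((p : Mink) 0) ^ n)⁻¹ *
        ‖beta s n p ((φ : lightCone → Spin n) p)‖ ^ 2 ∂coneMeasure : ℝ) : ℂ) := by
      rw [betaForm, ← integral_complex_ofReal]
      exact integral_congr_ae (Filter.Eventually.of_forall fun p => inner_beta_self s n p _)
    rw [h]
    exact integral_nonneg fun p => mul_nonneg (inv_nonneg.2 (pow_nonneg p.2.1.le n)) (sq_nonneg _)
  add_left φ χ ψ := by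
    rw [betaForm, betaForm, betaForm, ← integral_add (preSpace_integrable φ ψ) (preSpace_integrable χ ψ)]
    refine integral_congr_ae (Filter.Eventually.of_forall fun p => ?_)
    simp [density]
  smul_left φ ψ c := by
    rw [betaForm, betaForm, ← integral_const_mul]
    refine integral_congr_ae (Filter.Eventually.of_forall fun p => ?_)
    simp [density, mul_comm]

theorem betaForm_eq_zero_left {s : Helicity} {n : ℕ} {φ : preSpace s n}
    (h : betaForm s n φ φ = 0) (ψ : preSpace s n) : betaForm s n φ ψ = 0 := by
  let _ := preCore s n
  have hcs := InnerProductSpace.Core.inner_mul_inner_self_le (𝕜 := ℂ) φ ψ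
  have hs : ‖betaForm s n ψ φ‖ = ‖betaForm s n φ ψ‖ := by
    have := (preCore s n).conj_inner_symm φ ψ
    change (starRingEnd ℂ) (betaForm s n ψ φ) = betaForm s n φ ψ at this
    rw [← this, RCLike.norm_conj]
  change ‖betaForm s n φ ψ‖ * ‖betaForm s n ψ φ‖ ≤
    (betaForm s n φ φ).re * (betaForm s n ψ ψ).re at hcs
  rw [h, hs] at hcs
  simp at hcs
  have : ‖betaForm s n φ ψ‖ = 0 := by nlinarith [norm_nonneg (betaForm s n φ ψ)]
  exact norm_eq_zero.1 this

theorem betaForm_eq_zero_right {s : Helicity} {n : ℕ} {ψ : preSpace s n}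
    (h : betaForm s n ψ ψ = 0) (φ : preSpace s n) : betaForm s n φ ψ = 0 := by
  have := (preCore s n).conj_inner_symm φ ψ
  change (starRingEnd ℂ) (betaForm s n ψ φ) = betaForm s n φ ψ at this
  rw [← this, betaForm_eq_zero_left h, map_zero]

/-- `⟨·, ·⟩_β` as a sesquilinear map on `𝔥_{n,±}`. -/
def formMap (s : Helicity) (n : ℕ) : preSpace s n →ₗ⋆[ℂ] preSpace s n →ₗ[ℂ] ℂ :=
  LinearMap.mk₂'ₛₗ (starRingEnd ℂ) (RingHom.id ℂ)
    (fun φ ψ : preSpace s n => betaForm s n φ ψ)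
    (fun φ χ ψ => (preCore s n).add_left φ χ ψ)
    (fun c φ ψ => (preCore s n).smul_left φ ψ c)
    (fun φ ψ χ => by
      rw [betaForm, betaForm, betaForm, ← integral_add (preSpace_integrable φ ψ) (preSpace_integrable φ χ)]
      refine integral_congr_ae (Filter.Eventually.of_forall fun p => ?_)
      simp [density])
    (fun c φ ψ => by
      rw [betaForm, betaForm, RingHom.id_apply, smul_eq_mul, ← integral_const_mul]
      refine integral_congr_ae (Filter.Eventually.of_forall fun p => ?_)
      simp [density])

/-- The null space `{φ ∈ 𝔥_{n,±} | ⟨φ, φ⟩_β = 0}`. -/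
def nullSpace (s : Helicity) (n : ℕ) : Submodule ℂ (preSpace s n) where
  carrier := {φ | betaForm s n φ φ = 0}
  add_mem' := by
    intro φ ψ hφ hψ
    change formMap s n (φ + ψ) (φ + ψ) = 0
    simp only [map_add, LinearMap.add_apply]
    change (betaForm s n φ φ + betaForm s n ψ φ) + (betaForm s n φ ψ + betaForm s n ψ ψ) = 0
    rw [betaForm_eq_zero_left hφ, betaForm_eq_zero_left hψ, betaForm_eq_zero_left hφ,
      betaForm_eq_zero_left hψ]
    simp
  zero_mem' := by
    change formMap s n 0 0 = 0
    simp
  smul_mem' := by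
    intro c φ hφ
    change formMap s n (c • φ) (c • φ) = 0
    have : formMap s n φ φ = 0 := hφ
    simp [this]

/-- The factor space `𝔥'_{n,±}`, the quotient of `𝔥_{n,±}` by the null space. -/
def FactorSpace (s : Helicity) (n : ℕ) : Type := preSpace s n ⧸ nullSpace s n

instance (s : Helicity) (n : ℕ) : AddCommGroup (FactorSpace s n) :=
  inferInstanceAs (AddCommGroup (preSpace s n ⧸ nullSpace s n))

instance (s : Helicity) (n : ℕ) : Module ℂ (FactorSpace s n) :=
  inferInstanceAs (Module ℂ (preSpace s n ⧸ nullSpace s n))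

/-- The class `[φ]±` of `φ ∈ 𝔥_{n,±}`. -/
def toFactor (s : Helicity) (n : ℕ) : preSpace s n →ₗ[ℂ] FactorSpace s n :=
  (nullSpace s n).mkQ

theorem toFactor_surjective (s : Helicity) (n : ℕ) : Function.Surjective (toFactor s n) :=
  (nullSpace s n).mkQ_surjective

/-- The form on `𝔥'_{n,±}` induced by `⟨·, ·⟩_β`. -/
def factorForm (s : Helicity) (n : ℕ) : FactorSpace s n →ₗ⋆[ℂ] FactorSpace s n →ₗ[ℂ] ℂ :=
  (nullSpace s n).liftQ
    { toFun := fun φ => (nullSpace s n).liftQ (formMap s n φ)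
        fun ψ hψ => betaForm_eq_zero_right hψ φ
      map_add' := fun φ χ => by
        apply LinearMap.ext
        intro x
        obtain ⟨ψ, rfl⟩ := toFactor_surjective s n x
        exact congrArg (fun f => f ψ) ((formMap s n).map_add φ χ)
      map_smul' := fun c φ => by
        apply LinearMap.ext
        intro x
        obtain ⟨ψ, rfl⟩ := toFactor_surjective s n x
        exact congrArg (fun f => f ψ) ((formMap s n).map_smulₛₗ c φ) }
    (fun φ hφ => by
      apply LinearMap.ext
      intro x
      obtain ⟨ψ, rfl⟩ := toFactor_surjective s n x
      exact betaForm_eq_zero_left hφ ψ)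

/-- The scalar product `⟨[φ], [ψ]⟩ = ⟨φ, ψ⟩_β` on the factor space. -/
@[reducible] def factorCore (s : Helicity) (n : ℕ) : InnerProductSpace.Core ℂ (FactorSpace s n) where
  inner x y := factorForm s n x y
  conj_inner_symm x y := by
    obtain ⟨φ, rfl⟩ := toFactor_surjective s n x
    obtain ⟨ψ, rfl⟩ := toFactor_surjective s n y
    exact (preCore s n).conj_inner_symm φ ψ
  re_inner_nonneg x := by
    obtain ⟨φ, rfl⟩ := toFactor_surjective s n x
    exact (preCore s n).re_inner_nonneg φ
  add_left x y z := by simp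
  smul_left x y c := by simp
  definite x hx := by
    obtain ⟨φ, rfl⟩ := toFactor_surjective s n x
    exact (Submodule.Quotient.mk_eq_zero (nullSpace s n)).2 hx

instance (s : Helicity) (n : ℕ) : NormedAddCommGroup (FactorSpace s n) :=
  (factorCore s n).toNormedAddCommGroup

instance (s : Helicity) (n : ℕ) : InnerProductSpace ℂ (FactorSpace s n) :=
  InnerProductSpace.ofCore (factorCore s n).toCore

theorem inner_toFactor (s : Helicity) (n : ℕ) (φ ψ : preSpace s n) :
    inner ℂ (toFactor s n φ) (toFactor s n ψ) = betaForm s n φ ψ := rfl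

/-! ### The representations -/

/-- `V₁` (index `+`) and `V₂` (index `-`):
`(V(A, a) φ)(p) = e^{-ipa} D(A) φ(Λ_A⁻¹ p)`, with `D = D^{(0,n/2)}` and `D = D^{(n/2,0)}`
respectively. -/
def covAct (s : Helicity) (n : ℕ) (g : Poincare) (φ : lightCone → Spin n) : lightCone → Spin n :=
  fun p => Complex.exp (-Complex.I * mdot p g.trans) •
    rep s n (g.hom : Matrix (Fin 2) (Fin 2) ℂ) (φ (coneAct g.hom⁻¹ p))

/-- The matrix `H_p`, meaningful off the null set `p₃ = -p₀`. -/
def hMat (p : Mink) : Matrix (Fin 2) (Fin 2) ℂ :=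
  ((1 / Real.sqrt (2 * p 0 * (p 0 + p 3)) : ℝ) : ℂ) •
    !![-((Real.sqrt (p 0) * (p 0 + p 3) : ℝ) : ℂ),
        ((p 1 : ℂ) - Complex.I * p 2) / (Real.sqrt (p 0) : ℂ);
       -(Real.sqrt (p 0) : ℂ) * ((p 1 : ℂ) + Complex.I * p 2),
        -(((p 0 + p 3) / Real.sqrt (p 0) : ℝ) : ℂ)]

/-- `e^{-iθ(A,p)/2} = (H_p⁻¹ A H_q)₂₂` with `q = Λ_A⁻¹ p`. -/
def littlePhase (A : SL2C) (p : lightCone) : ℂ :=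
  ((hMat p)⁻¹ * (A : Matrix (Fin 2) (Fin 2) ℂ) * hMat (coneAct A⁻¹ p)) 1 1

/-- `e^{± iθ(A,p)/2}`; the number `e^{iθ/2}` is the conjugate of `e^{-iθ/2}`. -/
def helicityPhase : Helicity → SL2C → lightCone → ℂ
  | Helicity.plus, A, p => conj (littlePhase A p)
  | Helicity.minus, A, p => littlePhase A p

/-- The Hilbert space `L²` of the light cone. -/
abbrev ConeL2 : Type := Lp ℂ 2 coneMeasure

/-- The massless Wigner representation of helicity `±n/2` on functions:
`(U±(A, a) χ)(p) = e^{-ipa} (e^{± iθ(A,p)/2})ⁿ χ(Λ_A⁻¹ p)`. -/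
def wignerAct (s : Helicity) (n : ℕ) (g : Poincare) (χ : lightCone → ℂ) : lightCone → ℂ :=
  fun p => Complex.exp (-Complex.I * mdot p g.trans) * helicityPhase s g.hom p ^ n *
    χ (coneAct g.hom⁻¹ p)

/-- The function `p ↦ χ(p) D(H_p) (e₂ ⊗ ⋯ ⊗ e₂)`. -/
def wignerLift (s : Helicity) (n : ℕ) (χ : lightCone → ℂ) : lightCone → Spin n :=
  fun p => χ p • rep s n (hMat p) (spinVec n ![0, 1])

/-- A unitary representation is irreducible if the space is not zero and has no closed invariant
subspaces apart from `0` and itself. -/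
def IsIrreducibleRep {G E : Type} [Group G] [NormedAddCommGroup E] [InnerProductSpace ℂ E]
    (U : G →* (E ≃ₗᵢ[ℂ] E)) : Prop :=
  Nontrivial E ∧ ∀ K : Submodule ℂ E, IsClosed (K : Set E) → (∀ g, ∀ x ∈ K, U g x ∈ K) →
    K = ⊥ ∨ K = ⊤

end

end MasslessWigner

/-!
The form `⟨v, β(p) w⟩` on the spinor space has rank one on the light cone. With
`P = 2 H_p diag(1, 0) H_p*` and `det H_p = 1`, the matrix `P†` is `r* r`, where `r` is the second row
of `H_p⁻¹` (`pDagger_apply`). Hence `⟨φ(p), β(p) ψ(p)⟩ = conj (φ̂(p)) ψ̂(p)`, where the reduced wave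
function `φ̂(p)` is the `e₂ ⊗ ⋯ ⊗ e₂` component of `D(H_p⁻¹) φ(p)` (`density_eq_reduced`). The map
`φ ↦ φ̂` identifies the factor space with `L²`, and its inverse is `χ ↦ [χ(p) D(H_p) e₂ ⊗ ⋯ ⊗ e₂]`
(`wignerEquiv`).

The covariant action is an action by honest functions, and it is isometric for the form because
`A* P† A = Q†` for `P = A Q A*` and because `d³p / (2p₀)` is Lorentz invariant. So it descends to a
unitary representation of the factor space (`factorRep`). The Wigner representation is defined as
its transport to `L²`; computing the reduced wave function of `V(g) Φ χ` gives the formula with the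
little group phase (`reduced_covAct_wignerLift`). In this way the cocycle identity of the phases,
which holds only almost everywhere, is never needed.

Invariance of the measure is seen in the light-cone coordinates `t = log (p₀ + p₃)`,
`z = (p₁, p₂)`, in which the measure is half of Lebesgue measure
(`coneMeasure_eq_map_coneChart`) and the lower triangular matrices act by
`(t, z) ↦ (t + τ, z + c e^t)`. Together with one rotation by `π`, which preserves the measure by
symmetry, the lower unipotent matrices generate `SL(2,ℂ)`.

For irreducibility, let `f ≠ 0` lie in a closed invariant subspace and let `g` be orthogonal to it.
The scalar products of `g` with `U(A, a) f`, for all `a ∈ ℝ⁴`, are the Fourier transform of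
`conj g · U(A, 0) f`, which therefore vanishes almost everywhere. As the phases have modulus one,
`g` vanishes on almost all of every Lorentz translate of `{f ≠ 0}`. The lower triangular group acts
simply transitively on the coordinates `(t, z)`, so a Fubini argument
(`ae_notMem_or_ae_notMem`) shows that `g = 0`.
-/

namespace MasslessWigner

noncomputable section

/-! ### Spinor algebra -/

theorem hMat_zero_zero {p : Mink} (h0 : 0 < p 0) (hs : 0 < p 0 + p 3) :
    hMat p 0 0 = -((Real.sqrt ((p 0 + p 3) / 2) : ℝ) : ℂ) := by
  have h : 1 / Real.sqrt (2 * p 0 * (p 0 + p 3)) * (Real.sqrt (p 0) * (p 0 + p 3)) =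
      Real.sqrt ((p 0 + p 3) / 2) := by
    symm
    rw [Real.sqrt_eq_iff_mul_self_eq (by positivity) (by positivity)]
    have h1 := Real.mul_self_sqrt (show 0 ≤ 2 * p 0 * (p 0 + p 3) by positivity)
    have h2 := Real.mul_self_sqrt h0.le
    have h3 : Real.sqrt (2 * p 0 * (p 0 + p 3)) ≠ 0 := by positivity
    rw [show ∀ a b c : ℝ, 1 / a * (b * c) * (1 / a * (b * c)) = (b * b) * c ^ 2 / (a * a) by
      intro a b c; ring, h1, h2]
    field_simp
  rw [← h]
  simp [hMat]

theorem hMat_one_zero {p : Mink} (h0 : 0 < p 0) (hs : 0 < p 0 + p 3) :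
    hMat p 1 0 = -((p 1 : ℂ) + Complex.I * p 2) / (Real.sqrt (2 * (p 0 + p 3)) : ℝ) := by
  have h : 1 / Real.sqrt (2 * p 0 * (p 0 + p 3)) * Real.sqrt (p 0) =
      1 / Real.sqrt (2 * (p 0 + p 3)) := by
    rw [show 2 * p 0 * (p 0 + p 3) = p 0 * (2 * (p 0 + p 3)) by ring, Real.sqrt_mul h0.le]
    have h2 : Real.sqrt (p 0) ≠ 0 := by positivity
    field_simp
  have h' := congrArg (fun x : ℝ => (x : ℂ)) h
  simp only [Complex.ofReal_mul, Complex.ofReal_div, Complex.ofReal_one] at h'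
  simp only [hMat, Matrix.smul_apply, Matrix.of_apply, Matrix.cons_val', Matrix.cons_val_zero,
    Matrix.cons_val_one, Matrix.cons_val_fin_one, smul_eq_mul, Complex.ofReal_div,
    Complex.ofReal_one]
  linear_combination (-((p 1 : ℂ) + Complex.I * p 2)) * h'

theorem hMat_det {p : Mink} (hp : p ∈ lightCone) (hs : 0 < p 0 + p 3) : (hMat p).det = 1 := by
  have h0 := hp.1
  have hr : (Real.sqrt (p 0) : ℂ) ≠ 0 := by
    exact_mod_cast (Real.sqrt_pos.2 h0).ne'
  have h2 : ((Real.sqrt (2 * p 0 * (p 0 + p 3)) : ℝ) : ℂ) ^ 2 =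
      2 * p 0 * (p 0 + p 3) := by
    rw [← Complex.ofReal_pow, Real.sq_sqrt (by positivity)]
    push_cast
    ring
  have h3 : ((Real.sqrt (2 * p 0 * (p 0 + p 3)) : ℝ) : ℂ) ≠ 0 := by
    exact_mod_cast (Real.sqrt_pos.2 (by positivity)).ne'
  have h : (p 0 : ℂ) ^ 2 = (p 1 : ℂ) ^ 2 + (p 2 : ℂ) ^ 2 + (p 3 : ℂ) ^ 2 := by
    exact_mod_cast congrArg (fun x : ℝ => (x : ℂ)) hp.2
  rw [hMat, Matrix.det_smul, Matrix.det_fin_two]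
  simp only [Matrix.of_apply, Matrix.cons_val', Matrix.cons_val_zero,
    Matrix.cons_val_one, Matrix.cons_val_fin_one, Fintype.card_fin, Complex.ofReal_div,
    Complex.ofReal_one, Complex.ofReal_mul, Complex.ofReal_add]
  field_simp
  rw [h2]
  linear_combination (-(p 2 : ℂ) ^ 2) * Complex.I_sq - h

/-- On the cone the matrix `P†` has rank one: it is `r* r`, where `r` is the second row of `H_p⁻¹`
(the inverse being the adjugate). -/
theorem pDagger_apply {p : Mink} (hp : p ∈ lightCone) (hs : 0 < p 0 + p 3) (i j : Fin 2) :
    pDagger p i j = conj ((hMat p).adjugate 1 i) * (hMat p).adjugate 1 j := by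
  have h0 := hp.1
  obtain ⟨r, hr, hr2⟩ : ∃ r : ℝ, Real.sqrt ((p 0 + p 3) / 2) = r ∧ r ^ 2 = (p 0 + p 3) / 2 :=
    ⟨_, rfl, Real.sq_sqrt (by positivity)⟩
  have hr0 : (r : ℂ) ≠ 0 := by
    rw [← hr]
    exact_mod_cast (Real.sqrt_pos.2 (by positivity)).ne'
  have h00 := hMat_zero_zero h0 hs
  have h10 := hMat_one_zero h0 hs
  rw [show 2 * (p 0 + p 3) = 2 ^ 2 * ((p 0 + p 3) / 2) by ring, Real.sqrt_mul (by positivity),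
    Real.sqrt_sq (by norm_num), hr] at h10
  rw [hr] at h00
  have hq : (r : ℂ) ^ 2 = ((p 0 : ℂ) + p 3) / 2 := by
    rw [← Complex.ofReal_pow, hr2]
    push_cast
    ring
  have h : (p 0 : ℂ) ^ 2 = (p 1 : ℂ) ^ 2 + (p 2 : ℂ) ^ 2 + (p 3 : ℂ) ^ 2 := by
    exact_mod_cast congrArg (fun x : ℝ => (x : ℂ)) hp.2
  have hI := Complex.I_sq
  have h2 : (starRingEnd ℂ) (2 : ℂ) = 2 := map_ofNat _ 2
  rw [Matrix.adjugate_fin_two]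
  fin_cases i <;> fin_cases j <;>
    simp [pDagger, h00, h10, Complex.conj_ofReal, h2] <;> field_simp
  · linear_combination 2 * ((p 0 : ℂ) - p 3) * hq + (p 2 : ℂ) ^ 2 * hI + h
  · ring
  · ring
  · linear_combination (-2 : ℂ) * hq

theorem pDagger_eq_adjugate (p : Mink) : pDagger p = (1 / 2 : ℂ) • (toHerm p).adjugate := by
  rw [Matrix.adjugate_fin_two]
  ext i j
  fin_cases i <;> fin_cases j <;> simp [pDagger, toHerm] <;> ring

/-- Covariance of `P†`: `A* P† A = Q†` for `P = A Q A*`. -/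
theorem conjTranspose_mul_pDagger_mul (A : SL2C) (q : Mink) :
    (A : Matrix (Fin 2) (Fin 2) ℂ).conjTranspose * pDagger (lorentzFun A q) * A = pDagger q := by
  have hA : (A : Matrix (Fin 2) (Fin 2) ℂ).det = 1 := A.2
  have hA' : (A : Matrix (Fin 2) (Fin 2) ℂ).conjTranspose.det = 1 := by
    rw [Matrix.det_conjTranspose, hA, star_one]
  rw [pDagger_eq_adjugate, pDagger_eq_adjugate, toHerm_lorentzFun, Matrix.adjugate_mul_distrib,
    Matrix.adjugate_mul_distrib, Matrix.mul_smul, Matrix.smul_mul]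
  congr 1
  set B := (A : Matrix (Fin 2) (Fin 2) ℂ)
  calc B.conjTranspose * (B.conjTranspose.adjugate * ((toHerm q).adjugate * B.adjugate)) * B
      = (B.conjTranspose * B.conjTranspose.adjugate) * (toHerm q).adjugate * (B.adjugate * B) := by
        simp only [Matrix.mul_assoc]
    _ = _ := by rw [Matrix.mul_adjugate, Matrix.adjugate_mul, hA, hA']; simp

/-- The quadratic form of `mdot` is the determinant of `toHerm`. -/
theorem mdot_self_lorentzFun (A : SL2C) (x : Mink) :
    mdot (lorentzFun A x) (lorentzFun A x) = mdot x x := by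
  have key : ∀ y : Mink, ((mdot y y : ℝ) : ℂ) = (toHerm y).det := by
    intro y
    rw [det_toHerm, mdot]
    congr 1
    ring
  have hA : (A : Matrix (Fin 2) (Fin 2) ℂ).det = 1 := A.2
  apply Complex.ofReal_injective
  rw [key, key, toHerm_lorentzFun, Matrix.det_mul, Matrix.det_mul, Matrix.det_conjTranspose, hA]
  simp

theorem mdot_lorentzFun_lorentzFun (A : SL2C) (x y : Mink) :
    mdot (lorentzFun A x) (lorentzFun A y) = mdot x y := by
  have hadd := (lorentz A).map_add x y
  change lorentzFun A (x + y) = lorentzFun A x + lorentzFun A y at hadd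
  have h1 := mdot_self_lorentzFun A (x + y)
  have h2 := mdot_self_lorentzFun A x
  have h3 := mdot_self_lorentzFun A y
  rw [hadd] at h1
  simp only [mdot, Pi.add_apply] at h1 h2 h3 ⊢
  linarith

theorem mdot_lorentzFun (A : SL2C) (p b : Mink) :
    mdot p (lorentzFun A b) = mdot (lorentzFun A⁻¹ p) b := by
  rw [← mdot_lorentzFun_lorentzFun A (lorentzFun A⁻¹ p) b, ← lorentzFun_mul, mul_inv_cancel,
    lorentzFun_one]

theorem coneAct_one (p : lightCone) : coneAct 1 p = p := Subtype.ext (lorentzFun_one p)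

theorem coneAct_mul (A B : SL2C) (p : lightCone) : coneAct (A * B) p = coneAct A (coneAct B p) :=
  Subtype.ext (lorentzFun_mul A B p)

theorem coneAct_coneAct_inv (A : SL2C) (p : lightCone) : coneAct A (coneAct A⁻¹ p) = p := by
  rw [← coneAct_mul, mul_inv_cancel, coneAct_one]

theorem coneAct_inv_coneAct (A : SL2C) (p : lightCone) : coneAct A⁻¹ (coneAct A p) = p := by
  rw [← coneAct_mul, inv_mul_cancel, coneAct_one]

theorem continuous_toHerm : Continuous toHerm := by
  refine continuous_matrix fun i j => ?_
  fin_cases i <;> fin_cases j <;> simp [toHerm] <;> fun_prop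

theorem continuous_lorentzFun (A : SL2C) : Continuous (lorentzFun A) := by
  have h := continuous_toHerm
  have hE : ∀ i j, Continuous fun x => ((A : Matrix (Fin 2) (Fin 2) ℂ) * toHerm x *
      (A : Matrix (Fin 2) (Fin 2) ℂ).conjTranspose) i j := fun i j =>
    ((continuous_const.matrix_mul h).matrix_mul continuous_const).matrix_elem i j
  refine continuous_pi fun i => ?_
  have h00 := hE 0 0
  have h10 := hE 1 0
  have h11 := hE 1 1
  fin_cases i <;> simp only [lorentzFun, ofHerm] <;> simp <;> fun_prop

theorem measurable_coneAct (A : SL2C) : Measurable (coneAct A) :=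
  ((continuous_lorentzFun A).measurable.comp measurable_subtype_coe).subtype_mk

theorem twist_mul (s : Helicity) (M N : Matrix (Fin 2) (Fin 2) ℂ) :
    twist s (M * N) = twist s M * twist s N := by
  cases s
  · simp [twist, Matrix.map_mul]
  · rfl

theorem twist_one (s : Helicity) : twist s 1 = 1 := by
  cases s
  · simp [twist]
  · rfl

theorem twist_conjTranspose (s : Helicity) (M : Matrix (Fin 2) (Fin 2) ℂ) :
    twist s M.conjTranspose = (twist s M).conjTranspose := by
  cases s
  · ext i j; simp [twist]
  · rfl

theorem spinPow_one (n : ℕ) (v : Spin n) : spinPow n 1 v = v := by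
  apply Subtype.ext
  have : tensMat n 1 = 1 := by
    ext i j
    simp only [tensMat, Matrix.of_apply, Matrix.one_apply, Finset.prod_ite_zero,
      Finset.prod_const_one, Finset.mem_univ, true_implies, funext_iff]
  simp [spinPow, tensPow, this]

theorem rep_one (s : Helicity) (n : ℕ) (v : Spin n) : rep s n 1 v = v := by
  rw [rep, twist_one, spinPow_one]

theorem rep_mul (s : Helicity) (n : ℕ) (M N : Matrix (Fin 2) (Fin 2) ℂ) (v : Spin n) :
    rep s n (M * N) v = rep s n M (rep s n N v) := by
  apply Subtype.ext
  rw [rep, twist_mul]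
  exact tensPow_mul n _ _ _

/-- The adjoint of `⊗ⁿ M` is `⊗ⁿ M*`. -/
theorem inner_tensPow_left (n : ℕ) (M : Matrix (Fin 2) (Fin 2) ℂ) (t u : Tens n) :
    inner ℂ (tensPow n M t) u = inner ℂ t (tensPow n M.conjTranspose u) := by
  simp only [PiLp.inner_apply, tensPow_apply, RCLike.inner_apply, map_sum, map_mul, map_prod,
    Finset.mul_sum, Finset.sum_mul]
  rw [Finset.sum_comm]
  refine Finset.sum_congr rfl fun j _ => Finset.sum_congr rfl fun i _ => ?_
  simp only [Matrix.conjTranspose_apply, RCLike.star_def]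
  ring

/-- The form `β` is Lorentz invariant: `⟨D(A)v, β(Λ_A q) D(A)w⟩ = ⟨v, β(q) w⟩`. -/
theorem inner_rep_beta_rep (s : Helicity) (n : ℕ) (A : SL2C) (q : Mink) (v w : Spin n) :
    inner ℂ (rep s n (A : Matrix (Fin 2) (Fin 2) ℂ) v : Tens n)
      (beta s n (lorentzFun A q) (rep s n (A : Matrix (Fin 2) (Fin 2) ℂ) w) : Tens n) =
    inner ℂ (v : Tens n) (beta s n q w : Tens n) := by
  rw [beta, beta, ← conjTranspose_mul_pDagger_mul A q, rep_mul, rep_mul]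
  change inner ℂ (tensPow n _ _) _ = inner ℂ _ (tensPow n _ _)
  rw [inner_tensPow_left, ← twist_conjTranspose]
  rfl

/-! ### Light-cone coordinates -/

/-- The map `k ↦ (|k|, k)` of `ℝ³` onto the closed forward cone. -/
def massShell (k : Fin 3 → ℝ) : Mink := ![energy k, k 0, k 1, k 2]

/-- The measure `d³k / (2|k|)` on Minkowski space. -/
def shellMeasure : Measure Mink :=
  Measure.map massShell
    ((volume : Measure (Fin 3 → ℝ)).withDensity fun k => ENNReal.ofReal (1 / (2 * energy k)))

theorem coneMeasure_eq_comap : coneMeasure = Measure.comap Subtype.val shellMeasure := rfl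

theorem measurable_energy : Measurable energy := by
  unfold energy
  fun_prop

theorem measurable_massShell : Measurable massShell := by
  refine measurable_pi_lambda _ fun i => ?_
  have := measurable_energy
  fin_cases i <;> simp [massShell] <;> fun_prop

theorem measurableSet_lightCone : MeasurableSet lightCone := by
  refine (measurableSet_lt measurable_const (measurable_pi_apply 0)).inter
    (measurableSet_eq_fun ?_ ?_) <;> fun_prop

theorem massShell_mem_lightCone {k : Fin 3 → ℝ} (hk : k ≠ 0) : massShell k ∈ lightCone := by
  have hnn : 0 ≤ k 0 ^ 2 + k 1 ^ 2 + k 2 ^ 2 := by positivity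
  have hpos : 0 < k 0 ^ 2 + k 1 ^ 2 + k 2 ^ 2 := by
    refine lt_of_le_of_ne hnn fun h => hk ?_
    funext i
    have h0 : k 0 ^ 2 = 0 := by nlinarith [sq_nonneg (k 0), sq_nonneg (k 1), sq_nonneg (k 2)]
    have h1 : k 1 ^ 2 = 0 := by nlinarith [sq_nonneg (k 0), sq_nonneg (k 1), sq_nonneg (k 2)]
    have h2 : k 2 ^ 2 = 0 := by nlinarith [sq_nonneg (k 0), sq_nonneg (k 1), sq_nonneg (k 2)]
    fin_cases i
    · exact pow_eq_zero_iff two_ne_zero |>.1 h0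
    · exact pow_eq_zero_iff two_ne_zero |>.1 h1
    · exact pow_eq_zero_iff two_ne_zero |>.1 h2
  exact ⟨Real.sqrt_pos.2 hpos, Real.sq_sqrt hnn⟩

/-- Restricting to the cone loses no mass, as `massShell k` leaves it only for `k = 0`. -/
theorem map_val_coneMeasure : Measure.map Subtype.val coneMeasure = shellMeasure := by
  rw [coneMeasure_eq_comap, (MeasurableEmbedding.subtype_coe measurableSet_lightCone).map_comap,
    Subtype.range_coe_subtype]
  refine Measure.restrict_eq_self_of_ae_mem ?_
  change ∀ᵐ x ∂shellMeasure, x ∈ lightCone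
  rw [shellMeasure, ae_map_iff (p := (· ∈ lightCone)) measurable_massShell.aemeasurable
    measurableSet_lightCone]
  refine (withDensity_absolutelyContinuous _ _).ae_le ?_
  filter_upwards [measure_eq_zero_iff_ae_notMem.1 (measure_singleton (0 : Fin 3 → ℝ))] with k hk
  exact massShell_mem_lightCone hk

theorem ext_of_map_val {μ ν : Measure lightCone}
    (h : Measure.map Subtype.val μ = Measure.map Subtype.val ν) : μ = ν := by
  have he := MeasurableEmbedding.subtype_coe measurableSet_lightCone
  rw [← he.comap_map μ, h, he.comap_map ν]

/-- The light-cone parametrization by `t = log (p₀ + p₃)` and `z = (p₁, p₂)`. It covers the cone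
up to the null set `p₃ = -p₀`. -/
def coneChart (x : ℝ × (Fin 2 → ℝ)) : lightCone :=
  ⟨![(Real.exp x.1 + (x.2 0 ^ 2 + x.2 1 ^ 2) * Real.exp (-x.1)) / 2, x.2 0, x.2 1,
      (Real.exp x.1 - (x.2 0 ^ 2 + x.2 1 ^ 2) * Real.exp (-x.1)) / 2], by
    refine ⟨by simp only [Matrix.cons_val_zero]; positivity, ?_⟩
    have h : Real.exp x.1 * Real.exp (-x.1) = 1 := by rw [← Real.exp_add]; simp
    simp only [Matrix.cons_val]
    linear_combination (x.2 0 ^ 2 + x.2 1 ^ 2) * h⟩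

theorem measurable_coneChart : Measurable coneChart := by
  refine Measurable.subtype_mk (measurable_pi_lambda _ fun i => ?_)
  fin_cases i <;> simp <;> fun_prop

theorem coneChart_zero_add_three (x : ℝ × (Fin 2 → ℝ)) :
    (coneChart x : Mink) 0 + (coneChart x : Mink) 3 = Real.exp x.1 := by
  simp [coneChart]
  ring

/-- The substitution `k₃ = (e^t - r e^{-t}) / 2`, with `r = k₁² + k₂²` fixed: `dk₃ / |k| = dt`. -/
theorem lintegral_div_sqrt {r : ℝ} (hr : 0 < r) (F : ℝ → ENNReal) :
    ∫⁻ k, ENNReal.ofReal (1 / (2 * Real.sqrt (r + k ^ 2))) * F k =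
      ∫⁻ t, ENNReal.ofReal (1 / 2) * F ((Real.exp t - r * Real.exp (-t)) / 2) := by
  set f : ℝ → ℝ := fun t => (Real.exp t - r * Real.exp (-t)) / 2 with hf
  have hder : ∀ t, HasDerivAt f ((Real.exp t + r * Real.exp (-t)) / 2) t := by
    intro t
    have h1 := (Real.hasDerivAt_exp (-t)).comp t (hasDerivAt_neg t)
    have h2 := ((Real.hasDerivAt_exp t).sub (h1.const_mul r)).div_const 2
    exact h2.congr_deriv (by ring)
  have hmono : StrictMono f := by
    intro a b hab
    have h1 := Real.exp_lt_exp.2 hab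
    have h2 := Real.exp_lt_exp.2 (neg_lt_neg hab)
    simp only [hf]
    nlinarith
  have hsurj : Function.Surjective f := by
    intro k
    have hlt : k ^ 2 < r + k ^ 2 := by linarith
    have hs := Real.sq_sqrt (show 0 ≤ r + k ^ 2 by positivity)
    have hpos : 0 < k + Real.sqrt (r + k ^ 2) := by
      have : |k| < Real.sqrt (r + k ^ 2) := Real.lt_sqrt (abs_nonneg k) |>.2 (by rwa [sq_abs])
      linarith [neg_abs_le k]
    refine ⟨Real.log (k + Real.sqrt (r + k ^ 2)), ?_⟩
    simp only [hf]
    rw [Real.exp_neg, Real.exp_log hpos]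
    field_simp
    linear_combination hs
  have h := lintegral_image_eq_lintegral_abs_deriv_mul MeasurableSet.univ
    (fun t _ => (hder t).hasDerivWithinAt) hmono.injective.injOn
    (fun k => ENNReal.ofReal (1 / (2 * Real.sqrt (r + k ^ 2))) * F k)
  rw [Set.image_univ, hsurj.range_eq, setLIntegral_univ, setLIntegral_univ] at h
  rw [h]
  refine lintegral_congr fun t => ?_
  rw [← mul_assoc, ← ENNReal.ofReal_mul (abs_nonneg _)]
  congr 2
  have he : Real.exp t * Real.exp (-t) = 1 := by rw [← Real.exp_add]; simp
  have hq : Real.sqrt (r + f t ^ 2) = (Real.exp t + r * Real.exp (-t)) / 2 := by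
    rw [Real.sqrt_eq_iff_mul_self_eq (by positivity) (by positivity)]
    simp only [hf]
    linear_combination (-r) * he
  have hp : 0 < (Real.exp t + r * Real.exp (-t)) / 2 := by positivity
  rw [hq, abs_of_pos hp]
  field_simp

theorem shellMeasure_eq_map_coneChart :
    shellMeasure =
      Measure.map (fun x => (coneChart x : Mink)) (ENNReal.ofReal (1 / 2) • volume) := by
  have hc : Measurable fun x => (coneChart x : Mink) :=
    measurable_subtype_coe.comp measurable_coneChart
  refine Measure.ext_of_lintegral _ fun F hF => ?_
  have hm := measurable_energy
  rw [shellMeasure, lintegral_map hF measurable_massShell, lintegral_map hF hc,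
    lintegral_withDensity_eq_lintegral_mul (g := fun k => F (massShell k)) _ (by fun_prop)
      (hF.comp measurable_massShell), lintegral_smul_measure, smul_eq_mul,
    ← lintegral_const_mul (f := fun x => F (coneChart x)) _ (hF.comp hc)]
  have hvp := (volume_preserving_piFinSuccAbove (fun _ : Fin 3 => ℝ) 2).symm
  have hG : Measurable fun k => ENNReal.ofReal (1 / (2 * energy k)) * F (massShell k) :=
    (by fun_prop : Measurable fun k => ENNReal.ofReal (1 / (2 * energy k))).mul
      (hF.comp measurable_massShell)
  change ∫⁻ k, ENNReal.ofReal (1 / (2 * energy k)) * F (massShell k) = _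
  rw [← hvp.lintegral_comp hG, Measure.volume_eq_prod]
  refine ((lintegral_prod_symm' _ (hG.comp hvp.measurable)).trans ?_).trans
    (lintegral_prod_symm' _ ((hF.comp hc).const_mul _)).symm
  refine lintegral_congr_ae ?_
  filter_upwards [measure_eq_zero_iff_ae_notMem.1 (measure_singleton (0 : Fin 2 → ℝ))] with z hz
  have hr : 0 < z 0 ^ 2 + z 1 ^ 2 := by
    by_contra hcon
    refine hz ?_
    have h0 : z 0 ^ 2 = 0 := by nlinarith [sq_nonneg (z 0), sq_nonneg (z 1)]
    have h1 : z 1 ^ 2 = 0 := by nlinarith [sq_nonneg (z 0), sq_nonneg (z 1)]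
    funext i
    fin_cases i
    · exact pow_eq_zero_iff two_ne_zero |>.1 h0
    · exact pow_eq_zero_iff two_ne_zero |>.1 h1
  have key := lintegral_div_sqrt hr
    (fun k => F ![Real.sqrt (z 0 ^ 2 + z 1 ^ 2 + k ^ 2), z 0, z 1, k])
  refine (lintegral_congr fun k => rfl).trans (key.trans (lintegral_congr fun t => ?_))
  have he : Real.exp t * Real.exp (-t) = 1 := by rw [← Real.exp_add]; simp
  have hq : Real.sqrt (z 0 ^ 2 + z 1 ^ 2 +
      ((Real.exp t - (z 0 ^ 2 + z 1 ^ 2) * Real.exp (-t)) / 2) ^ 2) =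
      (Real.exp t + (z 0 ^ 2 + z 1 ^ 2) * Real.exp (-t)) / 2 := by
    rw [Real.sqrt_eq_iff_mul_self_eq (by positivity) (by positivity)]
    linear_combination (-(z 0 ^ 2 + z 1 ^ 2)) * he
  rw [hq]
  rfl

/-- In the coordinates `(t, z)` the invariant measure is half of Lebesgue measure. -/
theorem coneMeasure_eq_map_coneChart :
    coneMeasure = Measure.map coneChart (ENNReal.ofReal (1 / 2) • volume) := by
  apply ext_of_map_val
  rw [map_val_coneMeasure, Measure.map_map measurable_subtype_coe measurable_coneChart,
    shellMeasure_eq_map_coneChart]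
  rfl

theorem ae_coneMeasure_iff {Q : lightCone → Prop} (hQ : MeasurableSet {p | Q p}) :
    (∀ᵐ p ∂coneMeasure, Q p) ↔ ∀ᵐ x : ℝ × (Fin 2 → ℝ), Q (coneChart x) := by
  have h0 : ENNReal.ofReal (1 / 2) ≠ 0 := by simp
  rw [coneMeasure_eq_map_coneChart, ae_map_iff measurable_coneChart.aemeasurable hQ,
    Measure.ae_ennreal_smul_measure_iff h0]

theorem ae_energy_add_pos : ∀ᵐ p : lightCone ∂coneMeasure, 0 < (p : Mink) 0 + (p : Mink) 3 := by
  rw [ae_coneMeasure_iff]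
  · exact Filter.Eventually.of_forall fun x => by
      rw [coneChart_zero_add_three]; exact Real.exp_pos _
  · exact measurableSet_lt measurable_const (((measurable_pi_apply 0).comp measurable_subtype_coe).add
      ((measurable_pi_apply 3).comp measurable_subtype_coe))

/-! ### Lorentz invariance of the measure -/

/-- The lower triangular matrix with diagonal `e^{τ/2}, e^{-τ/2}` that acts on light-cone
coordinates by `(t, z) ↦ (t + τ, z + c e^t)`. -/
def lowerTri (τ : ℝ) (c : Fin 2 → ℝ) : SL2C :=
  ⟨!![(Real.exp (τ / 2) : ℂ), 0;
      (Real.exp (-τ / 2) : ℂ) * ((c 0 : ℂ) + Complex.I * c 1), (Real.exp (-τ / 2) : ℂ)], by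
    rw [Matrix.det_fin_two_of, zero_mul, sub_zero, ← Complex.ofReal_mul, ← Real.exp_add,
      show τ / 2 + -τ / 2 = 0 by ring, Real.exp_zero, Complex.ofReal_one]⟩

theorem coneAct_lowerTri (τ : ℝ) (c : Fin 2 → ℝ) (x : ℝ × (Fin 2 → ℝ)) :
    coneAct (lowerTri τ c) (coneChart x) = coneChart (x.1 + τ, x.2 + Real.exp x.1 • c) := by
  apply Subtype.ext
  apply toHerm_injective
  change toHerm (lorentzFun _ _) = _
  rw [toHerm_lorentzFun]
  have e1 : Real.exp (-x.1) = (Real.exp x.1)⁻¹ := Real.exp_neg _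
  have e2 : Real.exp (-τ / 2) = (Real.exp (τ / 2))⁻¹ := by rw [← Real.exp_neg]; congr 1; ring
  have e3 : Real.exp (x.1 + τ) = Real.exp x.1 * Real.exp (τ / 2) ^ 2 := by
    rw [← Real.exp_nat_mul, ← Real.exp_add]; congr 1; push_cast; ring
  have e4 : Real.exp (-(x.1 + τ)) = (Real.exp x.1 * Real.exp (τ / 2) ^ 2)⁻¹ := by
    rw [Real.exp_neg, e3]
  have h1 : (Real.exp x.1 : ℂ) ≠ 0 := by exact_mod_cast (Real.exp_pos _).ne'
  have h2 : (Real.exp (τ / 2) : ℂ) ≠ 0 := by exact_mod_cast (Real.exp_pos _).ne'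
  simp only [coneChart, lowerTri, e1, e2, e3, e4]
  generalize Real.exp x.1 = a at *
  generalize Real.exp (τ / 2) = b at *
  have hI := Complex.I_sq
  ext i j
  fin_cases i <;> fin_cases j <;>
    simp [toHerm, Matrix.mul_apply, Fin.sum_univ_two, Matrix.conjTranspose_apply,
      Complex.conj_ofReal] <;> field_simp <;> ring_nf
  simp only [hI]
  ring

/-- The rotation by `π` about the second axis. -/
def weylElt : SL2C := ⟨!![0, 1; -1, 0], by simp [Matrix.det_fin_two_of]⟩

/-- The lower unipotent matrix with off-diagonal entry `c`. -/
def lowerUnip (c : ℂ) : SL2C := ⟨!![1, 0; c, 1], by simp [Matrix.det_fin_two_of]⟩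

/-- The upper unipotent matrix with off-diagonal entry `b`. -/
def upperUnip (b : ℂ) : SL2C := ⟨!![1, b; 0, 1], by simp [Matrix.det_fin_two_of]⟩

@[simp] theorem coe_weylElt : (weylElt : Matrix (Fin 2) (Fin 2) ℂ) = !![0, 1; -1, 0] := rfl

@[simp] theorem coe_lowerUnip (c : ℂ) :
    (lowerUnip c : Matrix (Fin 2) (Fin 2) ℂ) = !![1, 0; c, 1] := rfl

@[simp] theorem coe_upperUnip (b : ℂ) :
    (upperUnip b : Matrix (Fin 2) (Fin 2) ℂ) = !![1, b; 0, 1] := rfl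

theorem lorentzFun_weylElt (p : Mink) : lorentzFun weylElt p = ![p 0, -p 1, p 2, -p 3] := by
  apply toHerm_injective
  rw [toHerm_lorentzFun]
  ext i j
  fin_cases i <;> fin_cases j <;>
    simp [toHerm, Matrix.mul_apply, Fin.sum_univ_two, Matrix.conjTranspose_apply] <;> ring

/-- In light-cone coordinates the lower triangular matrices act by translations and shears. -/
theorem measurePreserving_coneAct_lowerTri (τ : ℝ) (c : Fin 2 → ℝ) :
    MeasurePreserving (coneAct (lowerTri τ c)) coneMeasure coneMeasure := by
  have hT : MeasurePreserving (fun x : ℝ × (Fin 2 → ℝ) => (x.1 + τ, x.2 + Real.exp x.1 • c))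
      volume volume := by
    rw [Measure.volume_eq_prod]
    exact (measurePreserving_add_right volume τ).skew_product
      (g := fun t z => z + Real.exp t • c) (by fun_prop)
      (Filter.Eventually.of_forall fun t => (measurePreserving_add_right volume _).map_eq)
  refine ⟨measurable_coneAct _, ?_⟩
  rw [coneMeasure_eq_map_coneChart, Measure.map_map (measurable_coneAct _) measurable_coneChart]
  have : coneAct (lowerTri τ c) ∘ coneChart =
      coneChart ∘ fun x : ℝ × (Fin 2 → ℝ) => (x.1 + τ, x.2 + Real.exp x.1 • c) :=
    funext fun x => coneAct_lowerTri τ c x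
  rw [this, ← Measure.map_map measurable_coneChart hT.measurable, Measure.map_smul _, hT.map_eq]

theorem measurePreserving_coneAct_weylElt :
    MeasurePreserving (coneAct weylElt) coneMeasure coneMeasure := by
  refine ⟨measurable_coneAct _, ext_of_map_val ?_⟩
  have hL : Measurable (lorentzFun weylElt) := (continuous_lorentzFun _).measurable
  have h1 : Subtype.val ∘ coneAct weylElt = lorentzFun weylElt ∘ Subtype.val := rfl
  rw [Measure.map_map measurable_subtype_coe (measurable_coneAct _), h1,
    ← Measure.map_map hL measurable_subtype_coe, map_val_coneMeasure, shellMeasure]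
  set R : (Fin 3 → ℝ) → (Fin 3 → ℝ) := fun k i => (![-1, 1, -1] : Fin 3 → ℝ) i * k i with hR
  have hRv : MeasurePreserving R volume volume := by
    refine volume_preserving_pi fun i => ?_
    have hneg : MeasurePreserving (fun x : ℝ => -1 * x) volume volume := by
      simpa only [neg_one_mul] using! Measure.measurePreserving_neg (volume : Measure ℝ)
    have hid : MeasurePreserving (fun x : ℝ => 1 * x) volume volume := by
      simpa only [one_mul] using! MeasurePreserving.id (volume : Measure ℝ)
    fin_cases i
    · exact hneg
    · exact hid
    · exact hneg
  have hE : ∀ k, energy (R k) = energy k := fun k => by simp [energy, hR]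
  have hc : lorentzFun weylElt ∘ massShell = massShell ∘ R := by
    funext k
    have := hE k
    simp only [Function.comp, lorentzFun_weylElt]
    ext i
    fin_cases i <;> simp [massShell, hE] <;> simp [hR]
  rw [Measure.map_map hL measurable_massShell, hc,
    ← Measure.map_map measurable_massShell hRv.measurable]
  congr 1
  have hm : Measurable fun k => ENNReal.ofReal (1 / (2 * energy k)) := by
    have := measurable_energy
    fun_prop
  refine Measure.ext_of_lintegral _ fun F hF => ?_
  rw [lintegral_map hF hRv.measurable, lintegral_withDensity_eq_lintegral_mul
    (g := fun k => F (R k)) _ hm (hF.comp hRv.measurable), lintegral_withDensity_eq_lintegral_mul _ hm hF,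
    ← hRv.lintegral_comp (hm.mul hF)]
  simp [hE]

/-- The invariant measure is invariant under all of `SL(2,ℂ)`, which is generated by the lower
unipotent matrices and the Weyl element. -/
theorem measurePreserving_coneAct (A : SL2C) :
    MeasurePreserving (coneAct A) coneMeasure coneMeasure := by
  have hmul : ∀ A B : SL2C, MeasurePreserving (coneAct A) coneMeasure coneMeasure →
      MeasurePreserving (coneAct B) coneMeasure coneMeasure →
      MeasurePreserving (coneAct (A * B)) coneMeasure coneMeasure := fun A B hA hB => by
    have : coneAct (A * B) = coneAct A ∘ coneAct B := funext (coneAct_mul A B)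
    rw [this]
    exact hA.comp hB
  have hL : ∀ B : SL2C, B 0 0 = 1 → B 0 1 = 0 → B 1 1 = 1 →
      MeasurePreserving (coneAct B) coneMeasure coneMeasure := by
    intro B h00 h01 h11
    have : B = lowerTri 0 ![(B 1 0).re, (B 1 0).im] := by
      ext i j
      fin_cases i <;> fin_cases j <;> simp [lowerTri, h00, h01, h11]
      rw [mul_comm, Complex.re_add_im]
    rw [this]
    exact measurePreserving_coneAct_lowerTri _ _
  -- the Weyl element conjugates lower to upper unipotents, and its inverse is its cube
  have hU : ∀ B : SL2C, B 0 0 = 1 → B 1 0 = 0 → B 1 1 = 1 →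
      MeasurePreserving (coneAct B) coneMeasure coneMeasure := by
    intro B h00 h10 h11
    have hw := measurePreserving_coneAct_weylElt
    have : B = weylElt * lowerUnip (-B 0 1) *
        (weylElt * weylElt * weylElt) := by
      ext i j
      fin_cases i <;> fin_cases j <;>
        simp [Matrix.mul_apply, Fin.sum_univ_two, h00, h10, h11]
    rw [this]
    exact hmul _ _ (hmul _ _ hw (hL _ rfl rfl rfl)) (hmul _ _ (hmul _ _ hw hw) hw)
  -- if the upper right entry is nonzero, the matrix factors as lower times upper times lower unipotent
  have hgen : ∀ B : SL2C, B 0 1 ≠ 0 → MeasurePreserving (coneAct B) coneMeasure coneMeasure := by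
    intro B hb
    have hdet : B 0 0 * B 1 1 - B 0 1 * B 1 0 = 1 := by
      rw [← Matrix.det_fin_two]; exact B.2
    have : B = lowerUnip ((B 1 1 - 1) / B 0 1) *
        upperUnip (B 0 1) *
        lowerUnip ((B 0 0 - 1) / B 0 1) := by
      ext i j
      fin_cases i <;> fin_cases j <;> simp [Matrix.mul_apply, Fin.sum_univ_two] <;> field_simp
      · ring
      · linear_combination -hdet
      · ring
    rw [this]
    exact hmul _ _ (hmul _ _ (hL _ rfl rfl rfl) (hU _ rfl rfl rfl)) (hL _ rfl rfl rfl)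
  -- if the upper right entry vanishes, multiplying by an upper unipotent matrix makes it nonzero
  by_cases hb : A 0 1 = 0
  · have hdet : A 0 0 * A 1 1 - A 0 1 * A 1 0 = 1 := by
      rw [← Matrix.det_fin_two]; exact A.2
    have ha : A 0 0 ≠ 0 := fun h => by simp [h, hb] at hdet
    have : A = (A * upperUnip 1) * upperUnip (-1) := by
      ext i j
      fin_cases i <;> fin_cases j <;> simp [Matrix.mul_apply, Fin.sum_univ_two]
    rw [this]
    refine hmul _ _ (hgen _ ?_) (hU _ rfl rfl rfl)
    simp [Matrix.mul_apply, Fin.sum_univ_two, hb, ha]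
  · exact hgen A hb

/-! ### The reduced wave function -/

theorem measurable_spinPow {n : ℕ} {M : lightCone → Matrix (Fin 2) (Fin 2) ℂ}
    (hM : ∀ i j, Measurable fun p => M p i j) {ψ : lightCone → Spin n} (hψ : Measurable ψ) :
    Measurable fun p => spinPow n (M p) (ψ p) := by
  refine Measurable.subtype_mk (f := fun p => tensPow n (M p) (ψ p : Tens n))
    (h := fun p => (spinPow n (M p) (ψ p)).2) ?_
  refine (MeasurableEquiv.toLp 2 ((Fin n → Fin 2) → ℂ)).measurable.comp
    (measurable_pi_lambda (fun p i => tensPow n (M p) (ψ p : Tens n) i) fun i => ?_)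
  simp only [tensPow_apply]
  refine Finset.measurable_sum _ fun j _ => Measurable.mul
    (Finset.measurable_prod _ fun k _ => hM _ _) ?_
  have : Measurable fun t : Tens n => t j := (EuclideanSpace.proj j).continuous.measurable
  exact this.comp (measurable_subtype_coe.comp hψ)

theorem measurable_twist {s : Helicity} {M : lightCone → Matrix (Fin 2) (Fin 2) ℂ}
    (hM : ∀ i j, Measurable fun p => M p i j) (i j : Fin 2) :
    Measurable fun p => twist s (M p) i j := by
  cases s
  · exact Complex.continuous_conj.measurable.comp (hM i j)
  · exact hM i j

theorem measurable_hMat (i j : Fin 2) : Measurable fun p : lightCone => hMat p i j := by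
  have h : Measurable fun p : Mink => hMat p i j := by
    fin_cases i <;> fin_cases j <;>
      simp only [hMat, Matrix.smul_apply, Matrix.of_apply, Matrix.cons_val', Matrix.cons_val_zero,
        Matrix.cons_val_one, Matrix.cons_val_fin_one, smul_eq_mul, Fin.zero_eta, Fin.mk_one] <;>
      fun_prop
  exact h.comp measurable_subtype_coe

theorem measurable_adjugate_hMat (i j : Fin 2) :
    Measurable fun p : lightCone => (hMat p).adjugate i j := by
  simp only [Matrix.adjugate_fin_two]
  fin_cases i <;> fin_cases j
  · exact measurable_hMat 1 1
  · exact (measurable_hMat 0 1).neg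
  · exact (measurable_hMat 1 0).neg
  · exact measurable_hMat 0 0

/-- The component of `D(H_p⁻¹) φ(p)` along `e₂ ⊗ ⋯ ⊗ e₂`, the only one seen by `β(p)`. The inverse
is written as the adjugate, as `det H_p = 1` off the null set `p₃ = -p₀`. -/
def reduced (s : Helicity) (n : ℕ) (φ : lightCone → Spin n) (p : lightCone) : ℂ :=
  (rep s n (hMat p).adjugate (φ p) : Tens n) fun _ => 1

theorem measurable_reduced (s : Helicity) {n : ℕ} {φ : lightCone → Spin n} (hφ : Measurable φ) :
    Measurable (reduced s n φ) := by
  have : Measurable fun t : Tens n => t fun _ => 1 :=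
    (EuclideanSpace.proj (fun _ => 1)).continuous.measurable
  exact this.comp (measurable_subtype_coe.comp
    (measurable_spinPow (measurable_twist measurable_adjugate_hMat) hφ))

theorem twist_pDagger_apply (s : Helicity) {p : Mink} (hp : p ∈ lightCone) (hs : 0 < p 0 + p 3)
    (i j : Fin 2) : twist s (pDagger p) i j =
      conj (twist s (hMat p).adjugate 1 i) * twist s (hMat p).adjugate 1 j := by
  cases s
  · simp [twist, pDagger_apply hp hs]
  · exact pDagger_apply hp hs i j

/-- The form `β(p)` has rank one on `Sym(⊗ⁿ ℂ²)` and reads off the reduced wave function. -/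
theorem density_eq_reduced (s : Helicity) (n : ℕ) (φ ψ : lightCone → Spin n) {p : lightCone}
    (hs : 0 < (p : Mink) 0 + (p : Mink) 3) :
    density s n φ ψ p = conj (reduced s n φ p) * reduced s n ψ p := by
  change inner ℂ (φ p : Tens n) (tensPow n (twist s (pDagger p)) (ψ p : Tens n)) =
    conj (tensPow n (twist s (hMat p).adjugate) (φ p : Tens n) fun _ => 1) *
      tensPow n (twist s (hMat p).adjugate) (ψ p : Tens n) fun _ => 1
  simp only [PiLp.inner_apply, tensPow_apply, RCLike.inner_apply, map_sum, map_mul, map_prod,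
    twist_pDagger_apply s p.2 hs, Finset.prod_mul_distrib, Finset.sum_mul, Finset.mul_sum]
  rw [Finset.sum_comm]
  refine Finset.sum_congr rfl fun i _ => Finset.sum_congr rfl fun j _ => ?_
  ring

theorem memLp_reduced {s : Helicity} {n : ℕ} (φ : preSpace s n) :
    MemLp (reduced s n φ) 2 coneMeasure := by
  refine (memLp_two_iff_integrable_sq_norm
    (measurable_reduced s φ.2.1).aestronglyMeasurable).2 ?_
  refine φ.2.2.norm.congr ?_
  filter_upwards [ae_energy_add_pos] with p hp
  rw [density_eq_reduced s n _ _ hp, norm_mul, RCLike.norm_conj, sq]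

/-- The map `φ ↦ reduced φ` from `𝔥_{n,±}` to `L²`. -/
def reducedMap (s : Helicity) (n : ℕ) : preSpace s n →ₗ[ℂ] ConeL2 where
  toFun φ := (memLp_reduced φ).toLp _
  map_add' φ ψ := by
    rw [← MemLp.toLp_add]
    congr 1
    funext p
    simp [reduced]
  map_smul' c φ := by
    rw [RingHom.id_apply, ← MemLp.toLp_const_smul]
    congr 1
    funext p
    simp [reduced]

theorem coeFn_reducedMap {s : Helicity} {n : ℕ} (φ : preSpace s n) :
    reducedMap s n φ =ᵐ[coneMeasure] reduced s n φ :=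
  (memLp_reduced φ).coeFn_toLp

theorem inner_reducedMap {s : Helicity} {n : ℕ} (φ ψ : preSpace s n) :
    inner ℂ (reducedMap s n φ) (reducedMap s n ψ) = betaForm s n φ ψ := by
  rw [L2.inner_def, betaForm]
  refine integral_congr_ae ?_
  filter_upwards [coeFn_reducedMap φ, coeFn_reducedMap ψ, ae_energy_add_pos] with p h1 h2 hp
  rw [h1, h2, density_eq_reduced s n _ _ hp, RCLike.inner_apply, mul_comm]

theorem tensPow_spinVec (n : ℕ) (M : Matrix (Fin 2) (Fin 2) ℂ) (v : Fin 2 → ℂ) :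
    tensPow n M (spinVec n v : Tens n) = (spinVec n (M.mulVec v) : Tens n) := by
  ext i
  rw [tensPow_apply]
  simp only [spinVec, Matrix.mulVec, dotProduct, Finset.prod_univ_sum, Fintype.piFinset_univ,
    Finset.prod_mul_distrib]

theorem rep_spinVec_apply (s : Helicity) (n : ℕ) (M : Matrix (Fin 2) (Fin 2) ℂ) :
    (rep s n M (spinVec n ![0, 1]) : Tens n) (fun _ => 1) = (twist s M 1 1) ^ n := by
  change tensPow n (twist s M) (spinVec n ![0, 1] : Tens n) (fun _ => 1) = _
  rw [tensPow_spinVec]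
  simp [spinVec, Matrix.mulVec, dotProduct, Fin.sum_univ_two]

theorem reduced_wignerLift (s : Helicity) (n : ℕ) (χ : lightCone → ℂ) {p : lightCone}
    (hs : 0 < (p : Mink) 0 + (p : Mink) 3) : reduced s n (wignerLift s n χ) p = χ p := by
  have h : (hMat p).adjugate * hMat p = 1 := by
    rw [Matrix.adjugate_mul, hMat_det p.2 hs, one_smul]
  rw [reduced, wignerLift, map_smul, ← rep_mul, h, Submodule.coe_smul, PiLp.smul_apply,
    rep_spinVec_apply, twist_one, Matrix.one_apply_eq, one_pow, smul_eq_mul, mul_one]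

theorem wignerLift_mem (s : Helicity) (n : ℕ) (χ : ConeL2) : wignerLift s n χ ∈ preSpace s n := by
  refine ⟨(Lp.stronglyMeasurable χ).measurable.smul
    (measurable_spinPow (measurable_twist measurable_hMat) measurable_const), ?_⟩
  have h := L2.integrable_inner (𝕜 := ℂ) χ χ
  refine h.congr ?_
  filter_upwards [ae_energy_add_pos] with p hp
  rw [density_eq_reduced s n _ _ hp, reduced_wignerLift s n _ hp, RCLike.inner_apply, mul_comm]

theorem reducedMap_wignerLift (s : Helicity) (n : ℕ) (χ : ConeL2) :
    reducedMap s n ⟨wignerLift s n χ, wignerLift_mem s n χ⟩ = χ := by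
  refine Lp.ext ((coeFn_reducedMap _).trans ?_)
  filter_upwards [ae_energy_add_pos] with p hp
  exact reduced_wignerLift s n χ hp

/-- The isometry `𝔥'_{n,±} → L²` induced by `reducedMap`. -/
def factorToL2 (s : Helicity) (n : ℕ) : FactorSpace s n →ₗᵢ[ℂ] ConeL2 :=
  LinearMap.isometryOfInner
    ((nullSpace s n).liftQ (reducedMap s n) fun φ hφ => by
      have h : inner ℂ (reducedMap s n φ) (reducedMap s n φ) = 0 :=
        (inner_reducedMap φ φ).trans hφ
      exact inner_self_eq_zero.1 h : FactorSpace s n →ₗ[ℂ] ConeL2)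
    fun x y => by
      obtain ⟨φ, rfl⟩ := toFactor_surjective s n x
      obtain ⟨ψ, rfl⟩ := toFactor_surjective s n y
      exact inner_reducedMap φ ψ

theorem factorToL2_surjective (s : Helicity) (n : ℕ) : Function.Surjective (factorToL2 s n) :=
  fun χ => ⟨toFactor s n ⟨_, wignerLift_mem s n χ⟩, reducedMap_wignerLift s n χ⟩

/-- The unitary map `Φ±` from `L²` onto `𝔥'_{n,±}`. -/
def wignerEquiv (s : Helicity) (n : ℕ) : ConeL2 ≃ₗᵢ[ℂ] FactorSpace s n :=
  (LinearIsometryEquiv.ofSurjective (factorToL2 s n) (factorToL2_surjective s n)).symm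

theorem wignerEquiv_apply (s : Helicity) (n : ℕ) (χ : ConeL2) :
    wignerEquiv s n χ = toFactor s n ⟨_, wignerLift_mem s n χ⟩ :=
  (LinearIsometryEquiv.symm_apply_eq _).2 (reducedMap_wignerLift s n χ).symm

/-! ### The representations -/

theorem hom_one : (1 : Poincare).hom = 1 := rfl

theorem hom_mul (g h : Poincare) : (g * h).hom = g.hom * h.hom := rfl

theorem trans_one : (1 : Poincare).trans = 0 := rfl

theorem trans_mul (g h : Poincare) :
    (g * h).trans = g.trans + lorentzFun g.hom h.trans := rfl

theorem mdot_add (p a b : Mink) : mdot p (a + b) = mdot p a + mdot p b := by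
  simp only [mdot, Pi.add_apply]
  ring

theorem covAct_one (s : Helicity) (n : ℕ) (φ : lightCone → Spin n) : covAct s n 1 φ = φ := by
  funext p
  rw [covAct, hom_one, trans_one, inv_one, coneAct_one]
  simp [mdot, rep_one]

theorem covAct_mul (s : Helicity) (n : ℕ) (g h : Poincare) (φ : lightCone → Spin n) :
    covAct s n (g * h) φ = covAct s n g (covAct s n h φ) := by
  funext p
  rw [covAct, covAct, covAct, hom_mul, trans_mul, mul_inv_rev, coneAct_mul, mdot_add,
    mdot_lorentzFun, map_smul, smul_smul, Matrix.SpecialLinearGroup.coe_mul, rep_mul,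
    ← Complex.exp_add]
  congr 2
  simp only [coneAct]
  push_cast
  ring

theorem norm_exp_phase (x : ℝ) : ‖Complex.exp (-Complex.I * x)‖ = 1 := by
  rw [Complex.norm_exp]
  simp

theorem density_covAct (s : Helicity) (n : ℕ) (g : Poincare) (φ ψ : lightCone → Spin n)
    (p : lightCone) : density s n (covAct s n g φ) (covAct s n g ψ) p =
      density s n φ ψ (coneAct g.hom⁻¹ p) := by
  obtain ⟨q, rfl⟩ : ∃ q, p = coneAct g.hom q := ⟨_, (coneAct_coneAct_inv g.hom p).symm⟩
  have he := norm_exp_phase (mdot (coneAct g.hom q) g.trans)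
  simp only [density, covAct, coneAct_inv_coneAct]
  rw [(beta s n (coneAct g.hom q)).map_smul, Submodule.coe_smul, Submodule.coe_smul,
    inner_smul_left, inner_smul_right, ← mul_assoc, ← Complex.normSq_eq_conj_mul_self,
    Complex.normSq_eq_norm_sq, he, one_pow, Complex.ofReal_one, one_mul]
  exact inner_rep_beta_rep s n g.hom _ _ _

theorem measurable_covAct (s : Helicity) (n : ℕ) (g : Poincare) {φ : lightCone → Spin n}
    (hφ : Measurable φ) : Measurable (covAct s n g φ) := by
  have hD : Measurable fun p => rep s n (g.hom : Matrix (Fin 2) (Fin 2) ℂ)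
      (φ (coneAct g.hom⁻¹ p)) :=
    measurable_spinPow (M := fun _ => twist s (g.hom : Matrix (Fin 2) (Fin 2) ℂ))
      (fun _ _ => measurable_const) (hφ.comp (measurable_coneAct _))
  have he : Measurable fun p : Mink => Complex.exp (-Complex.I * mdot p g.trans) := by
    unfold mdot
    fun_prop
  exact (he.comp measurable_subtype_coe).smul hD

theorem covAct_mem (s : Helicity) (n : ℕ) (g : Poincare) (φ : preSpace s n) :
    covAct s n g φ ∈ preSpace s n := by
  refine ⟨measurable_covAct s n g φ.2.1, ?_⟩
  have : density s n (covAct s n g φ) (covAct s n g φ) =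
      density s n φ φ ∘ coneAct g.hom⁻¹ := funext (density_covAct s n g φ φ)
  rw [this]
  exact (measurePreserving_coneAct g.hom⁻¹).integrable_comp_of_integrable φ.2.2

theorem betaForm_covAct (s : Helicity) (n : ℕ) (g : Poincare) (φ ψ : preSpace s n) :
    betaForm s n (covAct s n g φ) (covAct s n g ψ) = betaForm s n φ ψ := by
  have h := measurePreserving_coneAct g.hom⁻¹
  simp only [betaForm, density_covAct]
  conv_rhs => rw [← h.map_eq]
  rw [integral_map h.measurable.aemeasurable
    (measurable_density s n φ.2.1 ψ.2.1).aestronglyMeasurable]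

/-- The operators `V₁(g)` and `V₂(g)` on `𝔥_{n,±}`. -/
def covMap (s : Helicity) (n : ℕ) (g : Poincare) : preSpace s n →ₗ[ℂ] preSpace s n where
  toFun φ := ⟨covAct s n g φ, covAct_mem s n g φ⟩
  map_add' φ ψ := by
    apply Subtype.ext
    funext p
    simp [covAct]
  map_smul' c φ := by
    apply Subtype.ext
    funext p
    simp [covAct, smul_smul, mul_comm]

/-- The isometries of `𝔥'_{n,±}` induced by `V₁(g)` and `V₂(g)`. -/
def factorIsometry (s : Helicity) (n : ℕ) (g : Poincare) :
    FactorSpace s n →ₗᵢ[ℂ] FactorSpace s n :=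
  LinearMap.isometryOfInner
    ((nullSpace s n).mapQ (nullSpace s n) (covMap s n g) fun φ hφ =>
      (betaForm_covAct s n g φ φ).trans hφ : FactorSpace s n →ₗ[ℂ] FactorSpace s n)
    fun x y => by
      obtain ⟨φ, rfl⟩ := toFactor_surjective s n x
      obtain ⟨ψ, rfl⟩ := toFactor_surjective s n y
      exact betaForm_covAct s n g φ ψ

/-- A multiplicative family of isometries indexed by a group is a unitary representation. -/
def unitaryRepOfIsometries {G E : Type*} [Group G] [NormedAddCommGroup E] [InnerProductSpace ℂ E]
    (L : G → E →ₗᵢ[ℂ] E) (h1 : ∀ x, L 1 x = x) (hmul : ∀ g h x, L (g * h) x = L g (L h x)) :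
    G →* (E ≃ₗᵢ[ℂ] E) where
  toFun g := LinearIsometryEquiv.ofSurjective (L g)
    fun x => ⟨L g⁻¹ x, by rw [← hmul, mul_inv_cancel, h1]⟩
  map_one' := LinearIsometryEquiv.ext h1
  map_mul' g h := LinearIsometryEquiv.ext (hmul g h)

/-- The unitary representations `V₁'` and `V₂'` on the factor spaces. -/
def factorRep (s : Helicity) (n : ℕ) : Poincare →* (FactorSpace s n ≃ₗᵢ[ℂ] FactorSpace s n) :=
  unitaryRepOfIsometries (factorIsometry s n)
    (fun x => by
      obtain ⟨φ, rfl⟩ := toFactor_surjective s n x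
      exact congrArg (toFactor s n) (Subtype.ext (covAct_one s n φ)))
    (fun g h x => by
      obtain ⟨φ, rfl⟩ := toFactor_surjective s n x
      exact congrArg (toFactor s n) (Subtype.ext (covAct_mul s n g h φ)))

theorem factorRep_toFactor (s : Helicity) (n : ℕ) (g : Poincare) (φ : preSpace s n) :
    factorRep s n g (toFactor s n φ) = toFactor s n ⟨_, covAct_mem s n g φ⟩ := rfl

/-- The Wigner representation, transported from `𝔥'_{n,±}` by `Φ±`. -/
def wignerRep (s : Helicity) (n : ℕ) : Poincare →* (ConeL2 ≃ₗᵢ[ℂ] ConeL2) where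
  toFun g := ((wignerEquiv s n).trans (factorRep s n g)).trans (wignerEquiv s n).symm
  map_one' := LinearIsometryEquiv.ext fun x => by simp
  map_mul' g h := LinearIsometryEquiv.ext fun x => by simp

theorem wignerEquiv_wignerRep (s : Helicity) (n : ℕ) (g : Poincare) (χ : ConeL2) :
    wignerEquiv s n (wignerRep s n g χ) = factorRep s n g (wignerEquiv s n χ) :=
  (wignerEquiv s n).apply_symm_apply _

theorem inv_hMat {p : Mink} (hp : p ∈ lightCone) (hs : 0 < p 0 + p 3) :
    (hMat p)⁻¹ = (hMat p).adjugate := by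
  rw [Matrix.inv_def, hMat_det hp hs, Ring.inverse_one, one_smul]

theorem twist_littlePhase (s : Helicity) (A : SL2C) {p : lightCone}
    (hs : 0 < (p : Mink) 0 + (p : Mink) 3) :
    twist s ((hMat p).adjugate * (A : Matrix (Fin 2) (Fin 2) ℂ) * hMat (coneAct A⁻¹ p)) 1 1 =
      helicityPhase s A p := by
  cases s <;> simp only [helicityPhase, littlePhase, inv_hMat p.2 hs] <;> rfl

theorem reduced_covAct_wignerLift (s : Helicity) (n : ℕ) (g : Poincare) (χ : lightCone → ℂ)
    {p : lightCone} (hs : 0 < (p : Mink) 0 + (p : Mink) 3) :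
    reduced s n (covAct s n g (wignerLift s n χ)) p = wignerAct s n g χ p := by
  rw [reduced, covAct, wignerLift, map_smul, map_smul, map_smul, ← rep_mul, ← rep_mul, smul_smul,
    Submodule.coe_smul, PiLp.smul_apply, rep_spinVec_apply, wignerAct, ← twist_littlePhase s _ hs,
    smul_eq_mul]
  ring

theorem coeFn_wignerRep (s : Helicity) (n : ℕ) (g : Poincare) (χ : ConeL2) :
    wignerRep s n g χ =ᵐ[coneMeasure] wignerAct s n g χ := by
  have h : wignerRep s n g χ = reducedMap s n ⟨_, covAct_mem s n g ⟨_, wignerLift_mem s n χ⟩⟩ := by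
    change (wignerEquiv s n).symm (factorRep s n g (wignerEquiv s n χ)) = _
    rw [wignerEquiv_apply]
    rfl
  rw [h]
  refine (coeFn_reducedMap _).trans ?_
  filter_upwards [ae_energy_add_pos] with p hp
  exact reduced_covAct_wignerLift s n g χ hp

/-- The little group phases have modulus one: for `n = 1` the function `V(A, 0) Φ(1)` has the
reduced wave function `helicityPhase s A`, and `V` preserves the density of the form. -/
theorem norm_helicityPhase (s : Helicity) (A : SL2C) {p : lightCone}
    (hs : 0 < (p : Mink) 0 + (p : Mink) 3)
    (hq : 0 < (coneAct A⁻¹ p : Mink) 0 + (coneAct A⁻¹ p : Mink) 3) :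
    ‖helicityPhase s A p‖ = 1 := by
  set g : Poincare := ⟨1, A⟩
  have h := density_covAct s 1 g (wignerLift s 1 1) (wignerLift s 1 1) p
  rw [density_eq_reduced s 1 _ _ hs, reduced_covAct_wignerLift s 1 g 1 hs] at h
  have hq' : density s 1 (wignerLift s 1 1) (wignerLift s 1 1) (coneAct A⁻¹ p) = 1 := by
    rw [density_eq_reduced s 1 _ _ hq, reduced_wignerLift s 1 _ hq]
    simp
  change _ = density s 1 _ _ (coneAct A⁻¹ p) at h
  rw [hq', wignerAct, pow_one, Pi.one_apply, mul_one] at h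
  have h' := congrArg norm h
  rw [norm_mul, RCLike.norm_conj, norm_mul, norm_exp_phase, one_mul, norm_one] at h'
  change ‖helicityPhase s A p‖ * ‖helicityPhase s A p‖ = 1 at h'
  nlinarith [norm_nonneg (helicityPhase s A p)]

/-! ### Uniqueness of Fourier transforms on the light cone -/

theorem measurable_exp_phase (a : Mink) :
    Measurable fun p : lightCone => Complex.exp (-Complex.I * mdot p a) := by
  have h : Measurable fun p : Mink => Complex.exp (-Complex.I * mdot p a) := by
    unfold mdot
    fun_prop
  exact h.comp measurable_subtype_coe

theorem integrable_exp_phase_mul {h : lightCone → ℂ} (hh : Integrable h coneMeasure) (a : Mink) :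
    Integrable (fun p : lightCone => Complex.exp (-Complex.I * mdot p a) * h p) coneMeasure :=
  hh.bdd_mul (c := 1) (measurable_exp_phase a).aestronglyMeasurable
    (Filter.Eventually.of_forall fun _ => (norm_exp_phase _).le)

theorem exists_eq_neg_mdot (L : StrongDual ℝ Mink) : ∃ a : Mink, ∀ p, L p = -mdot p a := by
  refine ⟨![-L (Pi.single 0 1), L (Pi.single 1 1), L (Pi.single 2 1), L (Pi.single 3 1)],
    fun p => ?_⟩
  have hp : p = ∑ i, p i • (Pi.single i (1 : ℝ) : Mink) := by
    simpa using! pi_eq_sum_univ' p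
  conv_lhs => rw [hp, map_sum]
  simp [mdot, Fin.sum_univ_four]
  ring

theorem charFunDual_withDensity {r : lightCone → ℝ} (hr : Integrable r coneMeasure)
    {L : StrongDual ℝ Mink} {a : Mink} (ha : ∀ p, L p = -mdot p a) :
    charFunDual (Measure.map Subtype.val
      (coneMeasure.withDensity fun p => ENNReal.ofReal (r p))) L =
      ∫ p : lightCone, Complex.exp (-Complex.I * mdot p a) * (max (r p) 0 : ℝ) ∂coneMeasure := by
  rw [charFunDual_apply, integral_map measurable_subtype_coe.aemeasurable
    (by fun_prop), integral_withDensity_eq_integral_toReal_smul₀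
    hr.aemeasurable.ennreal_ofReal (Filter.Eventually.of_forall fun _ => ENNReal.ofReal_lt_top)]
  refine integral_congr_ae (Filter.Eventually.of_forall fun p => ?_)
  simp only [ENNReal.toReal_ofReal', ha, Complex.real_smul]
  rw [mul_comm]
  congr 2
  push_cast
  ring

/-- The densities `r⁺` and `r⁻` have the same characteristic function, so they define the same
measure. -/
theorem ae_eq_zero_of_fourier_real {r : lightCone → ℝ} (hr : Integrable r coneMeasure)
    (h : ∀ a : Mink, ∫ p : lightCone, Complex.exp (-Complex.I * mdot p a) * r p ∂coneMeasure = 0) :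
    r =ᵐ[coneMeasure] 0 := by
  have hfin : ∀ u : lightCone → ℝ, Integrable u coneMeasure →
      IsFiniteMeasure (coneMeasure.withDensity fun p => ENNReal.ofReal (u p)) :=
    fun u hu => isFiniteMeasure_withDensity_ofReal hu.2
  have := hfin r hr
  have := hfin (-r) hr.neg
  have heq : Measure.map Subtype.val (coneMeasure.withDensity fun p => ENNReal.ofReal (r p)) =
      Measure.map Subtype.val (coneMeasure.withDensity fun p => ENNReal.ofReal ((-r) p)) := by
    refine Measure.ext_of_charFunDual (funext fun L => ?_)
    obtain ⟨a, ha⟩ := exists_eq_neg_mdot L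
    rw [charFunDual_withDensity hr ha, charFunDual_withDensity hr.neg ha, ← sub_eq_zero,
      ← integral_sub, ← h a]
    · refine integral_congr_ae (Filter.Eventually.of_forall fun p => ?_)
      simp only [Pi.neg_apply]
      rw [← mul_sub, ← Complex.ofReal_sub]
      congr 2
      rcases le_total 0 (r p) with h0 | h0
      · rw [max_eq_left h0, max_eq_right (by linarith), sub_zero]
      · rw [max_eq_right h0, max_eq_left (by linarith)]; ring
    · exact integrable_exp_phase_mul hr.pos_part.ofReal a
    · exact integrable_exp_phase_mul hr.neg.pos_part.ofReal a
  have h2 := (withDensity_eq_iff hr.aemeasurable.ennreal_ofReal hr.neg.aemeasurable.ennreal_ofReal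
    (by simpa using (measure_lt_top (coneMeasure.withDensity fun p => ENNReal.ofReal (r p))
      Set.univ).ne)).1 (ext_of_map_val heq)
  filter_upwards [h2] with p hp
  have h3 := congrArg ENNReal.toReal hp
  simp only [ENNReal.toReal_ofReal', Pi.neg_apply] at h3
  rcases le_total 0 (r p) with h0 | h0
  · rw [max_eq_left h0, max_eq_right (by linarith)] at h3
    exact h3
  · rw [max_eq_right h0, max_eq_left (by linarith)] at h3
    simpa using h3.symm

/-- An integrable function on the cone is determined by its Fourier transform on `ℝ⁴`. -/
theorem ae_eq_zero_of_fourier {h : lightCone → ℂ} (hh : Integrable h coneMeasure)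
    (h0 : ∀ a : Mink, ∫ p : lightCone, Complex.exp (-Complex.I * mdot p a) * h p ∂coneMeasure = 0) :
    h =ᵐ[coneMeasure] 0 := by
  have hconj : Integrable (fun p => conj (h p)) coneMeasure :=
    (Complex.conjCLE.toContinuousLinearMap.integrable_comp hh :)
  have h1 : ∀ a : Mink,
      ∫ p : lightCone, Complex.exp (-Complex.I * mdot p a) * conj (h p) ∂coneMeasure = 0 := by
    intro a
    have := congrArg conj (h0 (-a))
    rw [← integral_conj, map_zero] at this
    rw [← this]
    refine integral_congr_ae (Filter.Eventually.of_forall fun p => ?_)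
    simp only [map_mul, ← Complex.exp_conj, map_neg, Complex.conj_I, Complex.conj_ofReal]
    congr 2
    simp only [mdot, Pi.neg_apply]
    push_cast
    ring
  have hre := ae_eq_zero_of_fourier_real hh.re fun a => by
    have := integral_add (integrable_exp_phase_mul hh a) (integrable_exp_phase_mul hconj a)
    rw [h0, h1, add_zero] at this
    rw [← zero_div (2 : ℂ), ← this, ← integral_div]
    refine integral_congr_ae (Filter.Eventually.of_forall fun p => ?_)
    simp only [← mul_add, Complex.add_conj, RCLike.re_eq_complex_re]
    push_cast
    ring
  have him := ae_eq_zero_of_fourier_real hh.im fun a => by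
    have := integral_sub (integrable_exp_phase_mul hh a) (integrable_exp_phase_mul hconj a)
    rw [h0, h1, sub_zero] at this
    rw [← zero_div (2 * Complex.I : ℂ), ← this, ← integral_div]
    refine integral_congr_ae (Filter.Eventually.of_forall fun p => ?_)
    simp only [← mul_sub, Complex.sub_conj, RCLike.im_eq_complex_im]
    field_simp
    push_cast
    ring
  filter_upwards [hre, him] with p h2 h3
  exact Complex.ext h2 h3

/-! ### Ergodicity -/

/-- The lower triangular group acts ergodically on the cone: if `F` meets no translate of `G` in
positive measure, then `F` or `G` is null. By Fubini, if `G` is not null, it has a point `x` whose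
translate by almost every group element avoids `F`; as the orbit map of `x` is affine in light-cone
coordinates, almost every point of the cone is such a translate. -/
theorem ae_notMem_or_ae_notMem {F G : Set lightCone} (hF : MeasurableSet F) (hG : MeasurableSet G)
    (h : ∀ τ c, ∀ᵐ p ∂coneMeasure, p ∉ G ∨ coneAct (lowerTri τ c) p ∉ F) :
    (∀ᵐ p ∂coneMeasure, p ∉ G) ∨ ∀ᵐ p ∂coneMeasure, p ∉ F := by
  by_cases hG0 : ∀ᵐ p ∂coneMeasure, p ∉ G
  · exact Or.inl hG0
  refine Or.inr ((ae_coneMeasure_iff hF.compl).2 ?_)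
  rw [ae_coneMeasure_iff hG.compl] at hG0
  have h1 : ∀ᵐ y : ℝ × (Fin 2 → ℝ), ∀ᵐ x : ℝ × (Fin 2 → ℝ), coneChart x ∉ G ∨
      coneChart (x.1 + y.1, x.2 + Real.exp x.1 • y.2) ∉ F := by
    refine Filter.Eventually.of_forall fun y => ?_
    filter_upwards [(ae_coneMeasure_iff (hG.compl.union
      (measurable_coneAct (lowerTri y.1 y.2) hF.compl))).1 (h y.1 y.2)] with x hx
    rw [← coneAct_lowerTri]
    exact hx
  have hm : MeasurableSet {z : (ℝ × (Fin 2 → ℝ)) × (ℝ × (Fin 2 → ℝ)) | coneChart z.2 ∉ G ∨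
      coneChart (z.2.1 + z.1.1, z.2.2 + Real.exp z.2.1 • z.1.2) ∉ F} := by
    refine MeasurableSet.union (measurable_coneChart.comp measurable_snd hG.compl) ?_
    have : Measurable fun z : (ℝ × (Fin 2 → ℝ)) × (ℝ × (Fin 2 → ℝ)) =>
        (z.2.1 + z.1.1, z.2.2 + Real.exp z.2.1 • z.1.2) := by fun_prop
    exact measurable_coneChart.comp this hF.compl
  have h2 := (Measure.ae_ae_comm hm).1 h1
  -- a point of `G` from which almost every group element leads outside `F`
  obtain ⟨x, hxG, hx⟩ := ((Filter.not_eventually.1 hG0).and_eventually h2).exists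
  rw [not_not] at hxG
  -- the inverse of the orbit map `y ↦ (x.1 + y.1, x.2 + exp x.1 • y.2)`
  have hS : Measure.QuasiMeasurePreserving (fun x' : ℝ × (Fin 2 → ℝ) =>
      (x'.1 - x.1, (Real.exp x.1)⁻¹ • (x'.2 - x.2))) volume volume := by
    rw [Measure.volume_eq_prod]
    exact QuasiMeasurePreserving.prodMap
      (measurePreserving_sub_right volume x.1).quasiMeasurePreserving
      ((Measure.quasiMeasurePreserving_smul volume (inv_ne_zero (Real.exp_pos x.1).ne')).comp
        (measurePreserving_sub_right volume x.2).quasiMeasurePreserving)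
  filter_upwards [hS.ae hx] with x' hx'
  rcases hx' with h3 | h3
  · exact absurd hxG h3
  · simpa [smul_smul, (Real.exp_pos x.1).ne'] using h3

/-! ### Irreducibility -/

instance nontrivial_coneL2 : Nontrivial ConeL2 := by
  -- the indicator of the unit cube in light-cone coordinates
  set S : Set lightCone := {p | (p : Mink) 0 + (p : Mink) 3 ∈ Set.Icc (Real.exp 0) (Real.exp 1)} ∩
    {p | (fun i => (p : Mink) (![1, 2] i) : Fin 2 → ℝ) ∈ Set.Icc 0 1} with hS
  have hr : ∀ k : Fin 4, Measurable fun p : lightCone => (p : Mink) k := fun k =>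
    (measurable_pi_apply k).comp measurable_subtype_coe
  have hSm : MeasurableSet S :=
    (((hr 0).add (hr 3)) measurableSet_Icc).inter
      ((measurable_pi_lambda _ fun i => hr _) measurableSet_Icc)
  have hpre : coneChart ⁻¹' S = Set.Icc 0 1 ×ˢ Set.Icc 0 1 := by
    ext x
    have h1 : (fun i => (coneChart x : Mink) (![1, 2] i) : Fin 2 → ℝ) = x.2 := by
      funext i
      fin_cases i <;> rfl
    simp only [hS, Set.mem_preimage, Set.mem_inter_iff, Set.mem_ofPred_eq, h1, Set.mem_prod,
      coneChart_zero_add_three, Set.mem_Icc, Real.exp_le_exp]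
  have hμ : coneMeasure S = ENNReal.ofReal (1 / 2) := by
    rw [coneMeasure_eq_map_coneChart, Measure.map_apply measurable_coneChart hSm, hpre,
      Measure.smul_apply, Measure.volume_eq_prod, Measure.prod_prod, Real.volume_Icc,
      Real.volume_Icc_pi]
    simp
  have hfin : coneMeasure S ≠ ⊤ := by rw [hμ]; exact ENNReal.ofReal_ne_top
  refine ⟨⟨indicatorConstLp 2 hSm hfin (1 : ℂ), 0, fun h => ?_⟩⟩
  have h1 := congrArg norm h
  rw [norm_indicatorConstLp two_ne_zero ENNReal.ofNat_ne_top, norm_zero, Measure.real, hμ,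
    ENNReal.toReal_ofReal (by norm_num)] at h1
  simp at h1

/-- If `g` is orthogonal to the orbit of `f`, then `g` vanishes almost everywhere on each Lorentz
translate of `{f ≠ 0}`: integrating against all translations determines
`conj g · U(A, 0) f` through its Fourier transform. -/
theorem ae_eq_zero_or_of_inner_eq_zero (s : Helicity) (n : ℕ) (f g : ConeL2)
    (h : ∀ x, inner ℂ g (wignerRep s n x f) = 0) (A : SL2C) :
    ∀ᵐ p ∂coneMeasure, g p = 0 ∨ f (coneAct A p) = 0 := by
  set x : Mink → Poincare := fun a => ⟨Multiplicative.ofAdd a, A⁻¹⟩ with hx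
  have hzero := ae_eq_zero_of_fourier (L2.integrable_inner (𝕜 := ℂ) g (wignerRep s n (x 0) f))
    fun a => by
      rw [← h (x a), L2.inner_def]
      refine integral_congr_ae ?_
      filter_upwards [coeFn_wignerRep s n (x a) f, coeFn_wignerRep s n (x 0) f] with p h1 h2
      have h3 : wignerAct s n (x a) f p =
          Complex.exp (-Complex.I * mdot p a) * wignerAct s n (x 0) f p := by
        change Complex.exp (-Complex.I * mdot p a) * helicityPhase s A⁻¹ p ^ n *
          f (coneAct A⁻¹⁻¹ p) = _ * (Complex.exp (-Complex.I * mdot p 0) *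
            helicityPhase s A⁻¹ p ^ n * f (coneAct A⁻¹⁻¹ p))
        simp [mdot, mul_assoc]
      rw [h1, h2, h3, RCLike.inner_apply, RCLike.inner_apply, mul_assoc]
  have hq := (measurePreserving_coneAct A).quasiMeasurePreserving.ae ae_energy_add_pos
  filter_upwards [hzero, coeFn_wignerRep s n (x 0) f, ae_energy_add_pos, hq] with p h1 h2 hp hq
  rw [h2, RCLike.inner_apply, Pi.zero_apply, mul_eq_zero, map_eq_zero] at h1
  refine h1.symm.imp_right fun h3 => ?_
  change Complex.exp (-Complex.I * mdot p 0) * helicityPhase s A⁻¹ p ^ n *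
    f (coneAct A⁻¹⁻¹ p) = 0 at h3
  have hph := norm_helicityPhase s A⁻¹ hp (by rwa [inv_inv])
  have hph0 : helicityPhase s A⁻¹ p ≠ 0 := fun h => by rw [h, norm_zero] at hph; norm_num at hph
  rw [inv_inv] at h3
  exact (mul_eq_zero.1 h3).resolve_left (mul_ne_zero (Complex.exp_ne_zero _) (pow_ne_zero _ hph0))

theorem isIrreducibleRep_wignerRep (s : Helicity) (n : ℕ) : IsIrreducibleRep (wignerRep s n) := by
  refine ⟨inferInstance, fun K hK hinv => or_iff_not_imp_left.2 fun hbot => ?_⟩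
  obtain ⟨f, hf, hf0⟩ := K.ne_bot_iff.1 hbot
  have : CompleteSpace K := hK.completeSpace_coe
  rw [← Submodule.orthogonal_eq_bot_iff, Submodule.eq_bot_iff]
  intro g hg
  have hae := ae_eq_zero_or_of_inner_eq_zero s n f g fun x =>
    (Submodule.mem_orthogonal' K g).1 hg _ (hinv x f hf)
  have hmeas : ∀ u : ConeL2, MeasurableSet {p | u p ≠ 0} := fun u =>
    (Lp.stronglyMeasurable u).measurable (measurableSet_singleton 0).compl
  rcases ae_notMem_or_ae_notMem (hmeas f) (hmeas g) (fun τ c => by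
    simpa using hae (lowerTri τ c)) with h | h
  · exact (Lp.eq_zero_iff_ae_eq_zero).2 (h.mono fun p hp => by simpa using hp)
  · exact absurd ((Lp.eq_zero_iff_ae_eq_zero).2 (h.mono fun p hp => by simpa using hp)) hf0

end

end MasslessWigner

theorem mainTheorem3 (n : ℕ) (s : MasslessWigner.Helicity) :
    ∃ (U : MasslessWigner.Poincare →* (MasslessWigner.ConeL2 ≃ₗᵢ[ℂ] MasslessWigner.ConeL2))
      (V' : MasslessWigner.Poincare →*
        (MasslessWigner.FactorSpace s n ≃ₗᵢ[ℂ] MasslessWigner.FactorSpace s n))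
      (Φ : MasslessWigner.ConeL2 ≃ₗᵢ[ℂ] MasslessWigner.FactorSpace s n),
      (∀ g χ, (U g χ : MasslessWigner.lightCone → ℂ) =ᵐ[MasslessWigner.coneMeasure]
        MasslessWigner.wignerAct s n g χ) ∧
      MasslessWigner.IsIrreducibleRep U ∧
      (∀ g (φ : MasslessWigner.preSpace s n),
        ∃ h : MasslessWigner.covAct s n g φ ∈ MasslessWigner.preSpace s n,
          V' g (MasslessWigner.toFactor s n φ) = MasslessWigner.toFactor s n ⟨_, h⟩) ∧
      (∀ χ : MasslessWigner.ConeL2,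
        ∃ h : MasslessWigner.wignerLift s n χ ∈ MasslessWigner.preSpace s n,
          Φ χ = MasslessWigner.toFactor s n ⟨_, h⟩) ∧
      (∀ g χ, Φ (U g χ) = V' g (Φ χ)) :=
  ⟨MasslessWigner.wignerRep s n, MasslessWigner.factorRep s n, MasslessWigner.wignerEquiv s n,
    MasslessWigner.coeFn_wignerRep s n, MasslessWigner.isIrreducibleRep_wignerRep s n,
    fun g φ => ⟨MasslessWigner.covAct_mem s n g φ, MasslessWigner.factorRep_toFactor s n g φ⟩,
    fun χ => ⟨MasslessWigner.wignerLift_mem s n χ, MasslessWigner.wignerEquiv_apply s n χ⟩,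
    MasslessWigner.wignerEquiv_wignerRep s n⟩
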